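/- Let $X$ be a CAT(0) space, $\mathfrak o\in X$, and let $b:[0,\infty)\to X$ be a geodesic ray with $b(0)=\mathfrak o$. Let $\kappa:[0,\infty)\to[1,\infty)$ be a sublinear function, that is, a monotone increasing (not necessarily strictly), concave function with $\lim_{t\to\infty}\kappa(t)/t=0$. *Curtain model.* A curtain is a set $h=\pi_a^{-1}\big(a([r-\tfrac12,r+\tfrac12])\big)$, where $a:I\to X$ is a geodesic defined on a closed interval $I$, $\pi_a$ is the closest point projection to $a$, and $[r-\frac12,r+\frac12]$ is contained in the interior of $I$; its half spaces are $\pi_a^{-1}(a(I\cap(-\infty,r-\frac12)))$ and $\pi_a^{-1}(a(I\cap(r+\frac12,\infty)))$, and $h$ separates two sets if one lies in one half space and the other in the other. A chain is a sequence of pairwise disjoint curtains $h_i$ such that $h_i$ separates $h_{i-1}$ from $h_{i+1}$ for all $i$. Disjoint curtains $h,h'$ are $L$-separated if every chain, all of whose members meet both $h$ and $h'$, has cardinality at most $L$. An $L$-chain is a chain whose members are pairwise $L$-separated. Put $d_L(x,x)=0$ and, for $x\neq y$, $d_L(x,y)=1+\max\{|c| : c \text{ an } L\text{-chain each member of which separates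 } x \text{ from } y\}$. The curtain model is $\widehat X=(X,\hat d)$ with $\hat d(x,y)=\sum_{L=1}^\infty d_L(x,y)/L^3$. For $f:[0,\infty)\to[1,\infty)$, the ray $b$ is *$f$-contracting* if there is $C\ge 0$ such that for every $x\in X$ and every ball $B$ centered at $x$ with $B\cap b=\emptyset$, $\operatorname{diam}(\pi_b(B))<C\,f(d(\mathfrak o,x))$. It has an *$f$-persistent shadow* if there is $C>0$ such that $\hat d(b(s),b(t))\ge C\cdot\frac{t-s}{f(t)}-C$ for all $0\le s<t$. **Theorem.** Suppose that $b$ has infinite diameter in $\widehat X$. 1. If $b$ is $\kappa$-contracting and $\kappa^4$ is sublinear (i.e. $\kappa(t)^4/t\to0$ as $t\to\infty$), then $b$ has a $\kappa^4$-persistent shadow. 2. If $b$ has a $\kappa$-persistent shadow and $\kappa^2$ is sublinear (i.e. $\kappa(t)^2/t\to 0$ as $t\to\infty$), then $b$ is $\kappa^2$-contracting. -/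

import Mathlib

open Set Filter Topology
open scoped ENNReal

/-- `γ` restricted to `I` is a geodesic, i.e. an isometric embedding `I → X`. -/
def IsGeodesicOn {X : Type*} [MetricSpace X] (γ : ℝ → X) (I : Set ℝ) : Prop :=
  ∀ s ∈ I, ∀ t ∈ I, dist (γ s) (γ t) = |s - t|

/-- `γ`, restricted to `[0, d(x,y)]`, is a geodesic segment from `x` to `y`. -/
def IsSegment {X : Type*} [MetricSpace X] (γ : ℝ → X) (x y : X) : Prop :=
  IsGeodesicOn γ (Icc 0 (dist x y)) ∧ γ 0 = x ∧ γ (dist x y) = y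

/-- A CAT(0) space: a geodesic metric space whose geodesic triangles are at least as thin as
their comparison triangles in the Euclidean plane. Points `p`, `q` on two sides of a triangle are
compared with the points `p'`, `q'` of the comparison triangle at the same distances from the
endpoints of the respective sides. Two different sides of a triangle always share a vertex, which
is called `x` here; for two points on one side the comparison inequality is an equality. -/
structure IsCAT0 (X : Type*) [MetricSpace X] : Prop where
  exists_segment : ∀ x y : X, ∃ γ : ℝ → X, IsSegment γ x y
  comparison : ∀ (x y z : X) (α β : ℝ → X), IsSegment α x y → IsSegment β x z →
    ∀ x' y' z' : EuclideanSpace ℝ (Fin 2),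
      dist x' y' = dist x y → dist x' z' = dist x z → dist y' z' = dist y z →
    ∀ p ∈ α '' Icc 0 (dist x y), ∀ q ∈ β '' Icc 0 (dist x z),
    ∀ p' q' : EuclideanSpace ℝ (Fin 2),
      dist x' p' = dist x p → dist p' y' = dist p y →
      dist x' q' = dist x q → dist q' z' = dist q z →
      dist p q ≤ dist p' q'

/-- `p` is a point of `S` that is closest to `x`. If `S` is the image of a geodesic defined on a
nonempty closed interval of a CAT(0) space, there is exactly one such point, namely the closest
point projection of `x` to `S`. -/
def IsClosest {X : Type*} [MetricSpace X] (S : Set X) (x p : X) : Prop :=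
  p ∈ S ∧ ∀ q ∈ S, dist x p ≤ dist x q

/-- The image of `B` under the closest point projection to `S`. -/
def projImage {X : Type*} [MetricSpace X] (S B : Set X) : Set X :=
  {p | ∃ x ∈ B, IsClosest S x p}

/-- The preimage of `A` under the closest point projection to `S`. -/
def projPreimage {X : Type*} [MetricSpace X] (S A : Set X) : Set X :=
  {x | ∃ p ∈ A, IsClosest S x p}

/-- The data defining a curtain: a geodesic `path` on a closed interval `I` (bounded or not) and
a number `r` such that `[r - 1/2, r + 1/2]` lies in the interior of `I`. -/
structure Curtain (X : Type*) [MetricSpace X] where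
  I : Set ℝ
  isClosed_I : IsClosed I
  ordConnected_I : I.OrdConnected
  path : ℝ → X
  isGeodesicOn : IsGeodesicOn path I
  r : ℝ
  pole_subset : Icc (r - 1 / 2) (r + 1 / 2) ⊆ interior I

namespace Curtain

variable {X : Type*} [MetricSpace X]

/-- The curtain as a subset of `X`: the points that project to the pole. -/
def carrier (h : Curtain X) : Set X :=
  projPreimage (h.path '' h.I) (h.path '' Icc (h.r - 1 / 2) (h.r + 1 / 2))

/-- The half space of the points that project before the pole. -/
def neg (h : Curtain X) : Set X :=
  projPreimage (h.path '' h.I) (h.path '' (h.I ∩ Iio (h.r - 1 / 2)))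

/-- The half space of the points that project after the pole. -/
def pos (h : Curtain X) : Set X :=
  projPreimage (h.path '' h.I) (h.path '' (h.I ∩ Ioi (h.r + 1 / 2)))

/-- `h` separates `A` from `B`: they lie in different half spaces of `h`. -/
def Separates (h : Curtain X) (A B : Set X) : Prop :=
  (A ⊆ h.neg ∧ B ⊆ h.pos) ∨ (A ⊆ h.pos ∧ B ⊆ h.neg)

/-- The curtains meet. -/
def Meets (h k : Curtain X) : Prop :=
  (h.carrier ∩ k.carrier).Nonempty

end Curtain

/-- A (finite) chain of `n` curtains: they are pairwise disjoint, and every curtain separates its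
predecessor from its successor. -/
def IsChainOfCurtains {X : Type*} [MetricSpace X] {n : ℕ} (c : Fin n → Curtain X) : Prop :=
  (∀ i j, i ≠ j → Disjoint (c i).carrier (c j).carrier) ∧
  ∀ i j k : Fin n, (i : ℕ) + 1 = j → (j : ℕ) + 1 = k →
    (c j).Separates (c i).carrier (c k).carrier

/-- Disjoint curtains `h`, `k` are `L`-separated if every chain all of whose curtains meet both
`h` and `k` has cardinality at most `L`. -/
def IsLSeparated {X : Type*} [MetricSpace X] (L : ℕ) (h k : Curtain X) : Prop :=
  Disjoint h.carrier k.carrier ∧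
  ∀ (n : ℕ) (c : Fin n → Curtain X), IsChainOfCurtains c →
    (∀ i, (c i).Meets h ∧ (c i).Meets k) → n ≤ L

/-- An `L`-chain: a chain of curtains that are pairwise `L`-separated. -/
def IsLChain {X : Type*} [MetricSpace X] (L : ℕ) {n : ℕ} (c : Fin n → Curtain X) : Prop :=
  IsChainOfCurtains c ∧ ∀ i j, i ≠ j → IsLSeparated L (c i) (c j)

open Classical in
/-- The `L`-metric: `d_L(x,y)` is one more than the largest cardinality of an `L`-chain separating
`x` from `y` if `x ≠ y`, and `d_L(x,x) = 0`. It is finite in a CAT(0) space. -/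
noncomputable def dL {X : Type*} [MetricSpace X] (L : ℕ) (x y : X) : ℝ≥0∞ :=
  if x = y then 0 else
    1 + ⨆ (n : ℕ) (c : Fin n → Curtain X) (_ : IsLChain L c)
      (_ : ∀ i, (c i).Separates {x} {y}), (n : ℝ≥0∞)

/-- The metric of the curtain model: the sum of `d_L(x,y) / L³` over all `L ≥ 1`. -/
noncomputable def dHat {X : Type*} [MetricSpace X] (x y : X) : ℝ≥0∞ :=
  ∑' L : ℕ, dL (L + 1) x y / ((L + 1 : ℕ) : ℝ≥0∞) ^ 3

/-- `b`, restricted to `[0, ∞)`, is a geodesic ray emanating from `o`. -/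
def IsGeodesicRay {X : Type*} [MetricSpace X] (o : X) (b : ℝ → X) : Prop :=
  IsGeodesicOn b (Ici 0) ∧ b 0 = o

/-- The ray `b` has infinite diameter in the curtain model. -/
def HasInfiniteDiamHat {X : Type*} [MetricSpace X] (b : ℝ → X) : Prop :=
  (⨆ (s ∈ Ici (0 : ℝ)) (t ∈ Ici (0 : ℝ)), dHat (b s) (b t)) = ⊤

/-- `f(t) / t → 0` as `t → ∞`. -/
def GrowsSublinearly (f : ℝ → ℝ) : Prop :=
  Tendsto (fun t => f t / t) atTop (𝓝 0)

/-- `κ`, restricted to `[0, ∞)`, is a sublinear function `[0, ∞) → [1, ∞)`, with the usual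
convention that it is monotone and concave. -/
structure IsSublinearFunction (κ : ℝ → ℝ) : Prop where
  one_le : ∀ t, 0 ≤ t → 1 ≤ κ t
  growsSublinearly : GrowsSublinearly κ
  monotoneOn : MonotoneOn κ (Ici 0)
  concaveOn : ConcaveOn ℝ (Ici 0) κ

/-- The ray `b` is `f`-contracting: for some `C ≥ 0`, every ball centred at `x` and disjoint from
`b` has a projection to `b` of diameter less than `C * f(d(o,x))`. -/
def IsContractingRay {X : Type*} [MetricSpace X] (f : ℝ → ℝ) (o : X) (b : ℝ → X) : Prop :=
  ∃ C : ℝ, 0 ≤ C ∧ ∀ (x : X) (ρ : ℝ), 0 < ρ → Disjoint (Metric.ball x ρ) (b '' Ici 0) →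
    Metric.ediam (projImage (b '' Ici 0) (Metric.ball x ρ)) < ENNReal.ofReal (C * f (dist o x))

/-- The ray `b` has an `f`-persistent shadow: for some `C > 0` and all `0 ≤ s < t`, the distance
in the curtain model satisfies `d(b(s), b(t)) ≥ C * (t - s) / f(t) - C`. -/
def HasPersistentShadow {X : Type*} [MetricSpace X] (f : ℝ → ℝ) (b : ℝ → X) : Prop :=
  ∃ C : ℝ, 0 < C ∧ ∀ s t : ℝ, 0 ≤ s → s < t →
    ENNReal.ofReal (C * ((t - s) / f t) - C) ≤ dHat (b s) (b t)

/-! ### CAT(0) inequalities: Stewart, convexity of the distance, Reshetnyak -/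

section Stewart

variable {X : Type*} [MetricSpace X]

/-! Both implications compare the projection to `b` with curtains dual to `b` or separating points
of `b`. A curtain is a band of width 1 for a 1-Lipschitz coordinate with connected slabs, so
intermediate values produce crossings and nested half spaces turn the number of curtains into a
lower bound for distance.

Contracting implies shadow: up to time `t`, balls of radius `R = K * κ t` at height `R` project to
sets of radius at most `R / 20`. Hence a curtain crossing a stretch of length `4R + 1` of `b` has a
point over that stretch at height at most `R` (`IsContractingAtScale.exists_mem_carrier_near`).
Members of a chain crossing the same stretch thus have points in a set of diameter at most `6R + 1`,
which bounds their number. So dual curtains at spacing `4R + 2` are `L`-separated for some `L`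
comparable to `κ t`. Between `b s` and `b t` there are about `(t - s) / κ t` of them; the weight `1
/ L ^ 3` supplies the other three powers of `κ t`.

Shadow implies contracting: if `dist x y` is less than the distance from `x` to `b`, an `N`-chain
separating the feet of `x` and `y` has fewer than `3N + 14` members (`IsLChain.card_lt_of_dist_lt`):
many of its members would have to squeeze through the last stretch of length `N + 1` of the segment
from `x` to `y`. Splitting the series for `dHat` at `N` then bounds the distance of the feet in the
model by a multiple of `N + T / N`, up to a constant, where `T` is their distance along `b`. With
`N` a large multiple of `κ`, the persistent shadow absorbs `T / N` and leaves `T` at most a multiple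
of `κ ^ 2`. -/

theorem exists_comparison_point {a b c s : ℝ} (ha : 0 < a) (hb : 0 ≤ b) (hc : 0 ≤ c)
    (h₁ : a ≤ b + c) (h₂ : b ≤ a + c) (h₃ : c ≤ a + b) (hs : s ∈ Icc 0 a) :
    ∃ x y z p : EuclideanSpace ℝ (Fin 2), dist x y = a ∧ dist x z = b ∧ dist y z = c ∧
      dist x p = s ∧ dist p y = a - s ∧
      a * dist p z ^ 2 = (a - s) * b ^ 2 + s * c ^ 2 - s * (a - s) * a := by
  set u : ℝ := (a ^ 2 + b ^ 2 - c ^ 2) / (2 * a) with hu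
  have hua : 2 * a * u = a ^ 2 + b ^ 2 - c ^ 2 := by rw [hu]; field_simp
  have hub : u ^ 2 ≤ b ^ 2 := by
    apply sq_le_sq'
    · have : -(2 * a * b) ≤ 2 * a * u := by
        rw [hua]; nlinarith [mul_nonneg (sub_nonneg.2 h₃) (add_nonneg (add_nonneg ha.le hb) hc)]
      nlinarith
    · have : 2 * a * u ≤ 2 * a * b := by
        rw [hua]
        nlinarith [mul_nonneg (sub_nonneg.2 h₁) (sub_nonneg.2 h₂)]
      nlinarith
  have hv := Real.sq_sqrt (sub_nonneg.2 hub)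
  set v : ℝ := Real.sqrt (b ^ 2 - u ^ 2)
  have key : ∀ p q r t : ℝ, dist (!₂[p, q] : EuclideanSpace ℝ (Fin 2)) !₂[r, t]
      = Real.sqrt ((p - r) ^ 2 + (q - t) ^ 2) := by
    intro p q r t
    simp [EuclideanSpace.dist_eq, Fin.sum_univ_two, Real.dist_eq, sq_abs]
  refine ⟨!₂[0, 0], !₂[a, 0], !₂[u, v], !₂[s, 0], ?_, ?_, ?_, ?_, ?_, ?_⟩ <;> rw [key]
  · rw [Real.sqrt_eq_iff_mul_self_eq (by positivity) ha.le]; ring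
  · rw [Real.sqrt_eq_iff_mul_self_eq (by positivity) hb]; nlinarith
  · rw [Real.sqrt_eq_iff_mul_self_eq (by positivity) hc]; nlinarith
  · rw [Real.sqrt_eq_iff_mul_self_eq (by positivity) hs.1]; ring
  · rw [Real.sqrt_eq_iff_mul_self_eq (by positivity) (sub_nonneg.2 hs.2)]; ring
  · rw [Real.sq_sqrt (by positivity)]
    linear_combination (-s) * hua + a * hv

/-- Stewart's inequality: the distance from a point to a point of a segment is at most what it is
in the Euclidean plane. -/
theorem IsCAT0.stewart (hX : IsCAT0 X) {γ : ℝ → X} {x y : X} (hγ : IsSegment γ x y) (z : X)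
    {τ : ℝ} (hτ : τ ∈ Icc (0 : ℝ) 1) :
    dist (γ (τ * dist x y)) z ^ 2 ≤
      (1 - τ) * dist x z ^ 2 + τ * dist y z ^ 2 - τ * (1 - τ) * dist x y ^ 2 := by
  rcases (dist_nonneg : 0 ≤ dist x y).eq_or_lt with h0 | hpos
  · have hxy : x = y := dist_eq_zero.1 h0.symm
    subst hxy
    simp only [dist_self, mul_zero, hγ.2.1]
    linarith
  have hs : τ * dist x y ∈ Icc 0 (dist x y) :=
    ⟨mul_nonneg hτ.1 hpos.le, mul_le_of_le_one_left hpos.le hτ.2⟩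
  obtain ⟨x', y', z', p', h1, h2, h3, h4, h5, h6⟩ := exists_comparison_point hpos
    (dist_nonneg : 0 ≤ dist x z) (dist_nonneg : 0 ≤ dist y z)
    (by rw [dist_comm y z]; exact dist_triangle _ _ _)
    (dist_triangle _ _ _) (by rw [dist_comm x y]; exact dist_triangle _ _ _) hs
  obtain ⟨β, hβ⟩ := hX.exists_segment x z
  have hend : dist x y ∈ Icc 0 (dist x y) := ⟨hpos.le, le_rfl⟩
  have hst : (0 : ℝ) ∈ Icc 0 (dist x y) := ⟨le_rfl, hpos.le⟩
  have d1 : dist x (γ (τ * dist x y)) = τ * dist x y := by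
    have := hγ.1 _ hst _ hs
    rw [hγ.2.1] at this
    rw [this, zero_sub, abs_neg, abs_of_nonneg hs.1]
  have d2 : dist (γ (τ * dist x y)) y = dist x y - τ * dist x y := by
    have := hγ.1 _ hs _ hend
    rw [hγ.2.2] at this
    rw [this, abs_sub_comm, abs_of_nonneg (sub_nonneg.2 hs.2)]
  have hle := hX.comparison x y z γ β hγ hβ x' y' z' h1 h2 h3 _ (mem_image_of_mem γ hs) z
    ⟨dist x z, ⟨dist_nonneg, le_rfl⟩, hβ.2.2⟩ p' z' (h4.trans d1.symm) (h5.trans d2.symm) h2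
    (by simp)
  have hsq : dist (γ (τ * dist x y)) z ^ 2 ≤ dist p' z' ^ 2 := by gcongr
  refine le_of_mul_le_mul_left ?_ hpos
  nlinarith [mul_le_mul_of_nonneg_left hsq hpos.le]

/-- A subarc of a geodesic is a segment. -/
theorem IsGeodesicOn.isSegment {a : ℝ → X} {I : Set ℝ} (ha : IsGeodesicOn a I)
    (hI : I.OrdConnected) {s t : ℝ} (hs : s ∈ I) (ht : t ∈ I) (hst : s ≤ t) :
    IsSegment (fun u => a (s + u)) (a s) (a t) := by
  have hd : dist (a s) (a t) = t - s := by
    rw [ha s hs t ht, abs_sub_comm, abs_of_nonneg (sub_nonneg.2 hst)]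
  refine ⟨?_, by simp, by simp [hd]⟩
  rw [hd]
  intro u hu w hw
  rw [ha _ (hI.out hs ht ⟨by linarith [hu.1], by linarith [hu.2]⟩) _
    (hI.out hs ht ⟨by linarith [hw.1], by linarith [hw.2]⟩)]
  congr 1; ring

theorem IsCAT0.stewart_geodesic (hX : IsCAT0 X) {a : ℝ → X} {I : Set ℝ} (ha : IsGeodesicOn a I)
    (hI : I.OrdConnected) {s t : ℝ} (hs : s ∈ I) (ht : t ∈ I) (z : X)
    {τ : ℝ} (hτ : τ ∈ Icc (0 : ℝ) 1) :
    dist (a ((1 - τ) * s + τ * t)) z ^ 2 ≤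
      (1 - τ) * dist (a s) z ^ 2 + τ * dist (a t) z ^ 2 - τ * (1 - τ) * (s - t) ^ 2 := by
  wlog hst : s ≤ t generalizing s t τ
  · have := this ht hs (τ := 1 - τ) ⟨by linarith [hτ.2], by linarith [hτ.1]⟩ (le_of_not_ge hst)
    have e : (1 - (1 - τ)) * t + (1 - τ) * s = (1 - τ) * s + τ * t := by ring
    rw [e] at this
    linarith
  have := hX.stewart (ha.isSegment hI hs ht hst) z hτ
  rw [ha s hs t ht, sq_abs, abs_sub_comm, abs_of_nonneg (sub_nonneg.2 hst)] at this
  have e : s + τ * (t - s) = (1 - τ) * s + τ * t := by ring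
  simpa only [e] using this

/-- The distance to a point is convex along geodesics. -/
theorem IsCAT0.dist_geodesic_le (hX : IsCAT0 X) {a : ℝ → X} {I : Set ℝ} (ha : IsGeodesicOn a I)
    (hI : I.OrdConnected) {s t : ℝ} (hs : s ∈ I) (ht : t ∈ I) (z : X)
    {τ : ℝ} (hτ : τ ∈ Icc (0 : ℝ) 1) :
    dist (a ((1 - τ) * s + τ * t)) z ≤ (1 - τ) * dist (a s) z + τ * dist (a t) z := by
  have h := hX.stewart_geodesic ha hI hs ht z hτ
  have h1 : 0 ≤ 1 - τ := sub_nonneg.2 hτ.2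
  refine abs_le_of_sq_le_sq' ?_ (add_nonneg (mul_nonneg h1 dist_nonneg)
    (mul_nonneg hτ.1 dist_nonneg)) |>.2
  -- The gap between Stewart's bound and the square of the affine bound is `τ * (1 - τ)` times the
  -- difference of these two squares.
  have h2 : (dist (a s) z - dist (a t) z) ^ 2 ≤ (s - t) ^ 2 := by
    rw [sq_le_sq, ← ha s hs t ht]
    exact abs_dist_sub_le _ _ _
  nlinarith [mul_le_mul_of_nonneg_left h2 (mul_nonneg hτ.1 h1)]

/-- Reshetnyak's quadrilateral inequality. -/
theorem IsCAT0.quadrilateral (hX : IsCAT0 X) (x₁ x₂ x₃ x₄ : X) :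
    dist x₁ x₃ ^ 2 + dist x₂ x₄ ^ 2 ≤
      dist x₁ x₂ ^ 2 + dist x₃ x₄ ^ 2 + 2 * dist x₁ x₄ * dist x₂ x₃ := by
  rcases (dist_nonneg : 0 ≤ dist x₁ x₄).eq_or_lt with h0 | ha
  · obtain rfl : x₁ = x₄ := dist_eq_zero.1 h0.symm
    simp only [dist_comm x₃ x₁, dist_comm x₂ x₁, dist_self]
    linarith
  rcases (dist_nonneg : 0 ≤ dist x₂ x₃).eq_or_lt with h0 | hb
  · obtain rfl : x₂ = x₃ := dist_eq_zero.1 h0.symm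
    simp
  obtain ⟨γ, hγ⟩ := hX.exists_segment x₂ x₄
  set a := dist x₁ x₄
  set b := dist x₂ x₃
  -- The diagonal from `x₂` to `x₄` is cut in the ratio of the sides `b` and `a`. Stewart at this
  -- point, seen from `x₁` and from `x₃`, then makes the `a ^ 2` and `b ^ 2` terms combine into the
  -- product `2 * a * b`.
  set τ := b / (a + b) with hτ
  have hτ0 : 0 < τ := by positivity
  have hτ1 : 0 < 1 - τ := by
    have : 1 - τ = a / (a + b) := by rw [hτ]; field_simp; ring
    rw [this]; positivity
  have hτab : τ * a = (1 - τ) * b := by rw [hτ]; field_simp; ring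
  have hm : τ ∈ Icc (0 : ℝ) 1 := ⟨hτ0.le, by linarith⟩
  have s1 := hX.stewart hγ x₁ hm
  have s3 := hX.stewart hγ x₃ hm
  set g := γ (τ * dist x₂ x₄)
  rw [dist_comm x₂ x₁, dist_comm x₄ x₁] at s1
  rw [dist_comm x₄ x₃] at s3
  have tri : dist x₁ x₃ ≤ dist g x₁ + dist g x₃ := by
    rw [dist_comm g x₁]; exact dist_triangle _ _ _
  have tri2 : dist x₁ x₃ ^ 2 ≤ (dist g x₁ + dist g x₃) ^ 2 := by gcongr
  refine le_of_mul_le_mul_left ?_ (mul_pos hτ0 hτ1)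
  have e1 := mul_le_mul_of_nonneg_left tri2 (mul_pos hτ0 hτ1).le
  have e2 := sq_nonneg (τ * dist g x₁ - (1 - τ) * dist g x₃)
  have e3 := mul_le_mul_of_nonneg_left s1 hτ0.le
  have e4 := mul_le_mul_of_nonneg_left s3 hτ1.le
  have e5 : τ ^ 2 * a ^ 2 + (1 - τ) ^ 2 * b ^ 2 = 2 * (τ * (1 - τ)) * (a * b) := by
    linear_combination (τ * a - (1 - τ) * b) * hτab
  change τ * dist g x₁ ^ 2 ≤ τ * ((1 - τ) * dist x₁ x₂ ^ 2 + τ * a ^ 2 - _) at e3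
  change (1 - τ) * dist g x₃ ^ 2 ≤ (1 - τ) * ((1 - τ) * b ^ 2 + τ * dist x₃ x₄ ^ 2 - _) at e4
  linarith

end Stewart

/-! ### Closest point projection to a geodesic -/

section Projection

/-- `a` is a geodesic on the nonempty closed interval `I`. -/
structure IsClosedGeodesic {X : Type*} [MetricSpace X] (a : ℝ → X) (I : Set ℝ) : Prop where
  isClosed : IsClosed I
  ordConnected : I.OrdConnected
  nonempty : I.Nonempty
  isGeodesicOn : IsGeodesicOn a I

open Classical in
/-- The parameter of the closest point projection of `x` to the geodesic `a` on `I`. -/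
noncomputable def projParam {X : Type*} [MetricSpace X] (a : ℝ → X) (I : Set ℝ) (x : X) : ℝ :=
  if h : ∃ t ∈ I, IsClosest (a '' I) x (a t) then h.choose else 0

variable {X : Type*} [MetricSpace X] {a : ℝ → X} {I : Set ℝ}

theorem IsGeodesicOn.continuousOn (ha : IsGeodesicOn a I) : ContinuousOn a I := by
  have : LipschitzOnWith 1 a I := LipschitzOnWith.of_dist_le_mul fun s hs t ht => by
    simp [ha s hs t ht, Real.dist_eq]
  exact this.continuousOn

theorem IsClosedGeodesic.exists_isClosest (ha : IsClosedGeodesic a I) (x : X) :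
    ∃ t ∈ I, IsClosest (a '' I) x (a t) := by
  obtain ⟨t₀, ht₀⟩ := ha.nonempty
  have hcont : ContinuousOn (fun t => dist x (a t)) I :=
    continuous_dist.comp_continuousOn
      (continuousOn_const.prodMk ha.isGeodesicOn.continuousOn)
  -- Parameters outside this window are at least as far from `x` as `t₀` is, so an unbounded `I`
  -- does no harm.
  set K := I ∩ Icc (t₀ - 2 * dist x (a t₀)) (t₀ + 2 * dist x (a t₀))
  have hK : IsCompact K := isCompact_Icc.inter_left ha.isClosed
  have hd : 0 ≤ dist x (a t₀) := dist_nonneg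
  obtain ⟨t, htK, ht⟩ := hK.exists_isMinOn ⟨t₀, ht₀, by linarith, by linarith⟩
    (hcont.mono inter_subset_left)
  refine ⟨t, htK.1, mem_image_of_mem a htK.1, ?_⟩
  rintro _ ⟨s, hs, rfl⟩
  by_cases hsK : s ∈ K
  · exact ht hsK
  · have h1 : dist x (a t) ≤ dist x (a t₀) := ht ⟨ht₀, by linarith, by linarith⟩
    have h2 : 2 * dist x (a t₀) ≤ |s - t₀| := by
      by_contra! h
      exact hsK ⟨hs, by linarith [(abs_lt.1 h).1], by linarith [(abs_lt.1 h).2]⟩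
    rw [← ha.isGeodesicOn s hs t₀ ht₀] at h2
    have := dist_triangle_left (a s) (a t₀) x
    linarith

theorem IsClosedGeodesic.projParam_spec (ha : IsClosedGeodesic a I) (x : X) :
    projParam a I x ∈ I ∧ IsClosest (a '' I) x (a (projParam a I x)) := by
  have h := ha.exists_isClosest x
  rw [projParam, dif_pos h]
  exact h.choose_spec

theorem IsClosedGeodesic.projParam_mem (ha : IsClosedGeodesic a I) (x : X) :
    projParam a I x ∈ I := (ha.projParam_spec x).1

theorem IsClosedGeodesic.dist_proj_le (ha : IsClosedGeodesic a I) (x : X) {t : ℝ} (ht : t ∈ I) :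
    dist x (a (projParam a I x)) ≤ dist x (a t) :=
  (ha.projParam_spec x).2.2 _ (mem_image_of_mem a ht)

/-- First variation: moving from the foot `a p` a fraction `τ` of the way towards `a t` cannot
decrease the distance to `x`. Stewart bounds that distance above, so the defect of the inequality is
at most `τ * (t - p) ^ 2`, and `τ` can be taken small. -/
theorem IsCAT0.pythagoras_of_isClosest (hX : IsCAT0 X) (ha : IsClosedGeodesic a I) {x : X}
    {p t : ℝ} (hp : p ∈ I) (hc : IsClosest (a '' I) x (a p)) (ht : t ∈ I) :
    dist x (a p) ^ 2 + (t - p) ^ 2 ≤ dist x (a t) ^ 2 := by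
  by_contra! hlt
  have hmin : ∀ τ ∈ Ioc (0 : ℝ) 1,
      dist x (a p) ^ 2 + (t - p) ^ 2 - dist x (a t) ^ 2 ≤ τ * (t - p) ^ 2 := by
    intro τ hτ
    have hτ' : τ ∈ Icc (0 : ℝ) 1 := ⟨hτ.1.le, hτ.2⟩
    have hmem : (1 - τ) * p + τ * t ∈ I :=
      ha.ordConnected.convex hp ht (sub_nonneg.2 hτ.2) hτ.1.le (by ring)
    have h1 := hX.stewart_geodesic ha.isGeodesicOn ha.ordConnected hp ht x hτ'
    have h2 : dist x (a p) ^ 2 ≤ dist (a ((1 - τ) * p + τ * t)) x ^ 2 := by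
      rw [dist_comm _ x]
      gcongr
      exact hc.2 _ (mem_image_of_mem a hmem)
    rw [dist_comm (a p), dist_comm (a t)] at h1
    refine le_of_mul_le_mul_left ?_ hτ.1
    nlinarith
  set e := dist x (a p) ^ 2 + (t - p) ^ 2 - dist x (a t) ^ 2 with he
  have hepos : 0 < e := by linarith
  have hle : e ≤ (t - p) ^ 2 := by simpa using hmin 1 ⟨one_pos, le_rfl⟩
  have hδ : 0 < (t - p) ^ 2 := hepos.trans_le hle
  have := hmin (e / (2 * (t - p) ^ 2)) ⟨by positivity, by
    rw [div_le_one (by positivity)]; linarith⟩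
  have e2 : e / (2 * (t - p) ^ 2) * (t - p) ^ 2 = e / 2 := by
    rw [div_mul_eq_mul_div, mul_comm 2, ← div_div, mul_div_assoc, div_self hδ.ne', mul_one]
  linarith

theorem IsCAT0.projParam_eq (hX : IsCAT0 X) (ha : IsClosedGeodesic a I) {x : X} {t : ℝ}
    (ht : t ∈ I) (hc : IsClosest (a '' I) x (a t)) : projParam a I x = t := by
  have h1 := hX.pythagoras_of_isClosest ha ht hc (ha.projParam_mem x)
  have h2 : dist x (a (projParam a I x)) ^ 2 ≤ dist x (a t) ^ 2 := by
    gcongr; exact ha.dist_proj_le x ht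
  have h3 : (projParam a I x - t) ^ 2 = 0 := le_antisymm (by linarith) (sq_nonneg _)
  exact sub_eq_zero.1 (pow_eq_zero_iff two_ne_zero |>.1 h3)

theorem IsCAT0.pythagoras (hX : IsCAT0 X) (ha : IsClosedGeodesic a I) (x : X) {t : ℝ}
    (ht : t ∈ I) :
    dist x (a (projParam a I x)) ^ 2 + (t - projParam a I x) ^ 2 ≤ dist x (a t) ^ 2 :=
  hX.pythagoras_of_isClosest ha (ha.projParam_mem x) (ha.projParam_spec x).2 ht

theorem IsCAT0.projParam_self (hX : IsCAT0 X) (ha : IsClosedGeodesic a I) {t : ℝ} (ht : t ∈ I) :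
    projParam a I (a t) = t :=
  hX.projParam_eq ha ht ⟨mem_image_of_mem a ht, fun q _ => by simp⟩

/-- The closest point projection to a geodesic is 1-Lipschitz. -/
theorem IsCAT0.abs_projParam_sub_le (hX : IsCAT0 X) (ha : IsClosedGeodesic a I) (x y : X) :
    |projParam a I x - projParam a I y| ≤ dist x y := by
  set p := projParam a I x
  set q := projParam a I y
  have hp : p ∈ I := ha.projParam_mem x
  have hq : q ∈ I := ha.projParam_mem y
  have h1 := hX.pythagoras ha x hq
  have h2 := hX.pythagoras ha y hp
  -- Adding the two Pythagorean inequalities to this one cancels the distances to the feet and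
  -- leaves `|p - q| ^ 2 ≤ dist x y * |p - q|`.
  have h3 := hX.quadrilateral x (a p) (a q) y
  rw [ha.isGeodesicOn p hp q hq, dist_comm (a p) y, dist_comm (a q) y] at h3
  rcases (abs_nonneg (p - q)).eq_or_lt with h0 | hpos
  · rw [← h0]; exact dist_nonneg
  refine le_of_mul_le_mul_right ?_ hpos
  have h4 : |p - q| * |p - q| = (p - q) ^ 2 := by rw [← sq, sq_abs]
  change dist x (a p) ^ 2 + (q - p) ^ 2 ≤ _ at h1
  change dist y (a q) ^ 2 + (p - q) ^ 2 ≤ _ at h2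
  nlinarith

theorem IsCAT0.lipschitzWith_projParam (hX : IsCAT0 X) (ha : IsClosedGeodesic a I) :
    LipschitzWith 1 (projParam a I) :=
  LipschitzWith.of_dist_le_mul fun x y => by
    simpa [Real.dist_eq] using hX.abs_projParam_sub_le ha x y

/-- A point between `x` and its projection has the same projection as `x`. -/
theorem IsCAT0.projParam_eq_of_dist_add (hX : IsCAT0 X) (ha : IsClosedGeodesic a I) {x z : X}
    (hz : dist x z + dist z (a (projParam a I x)) = dist x (a (projParam a I x))) :
    projParam a I z = projParam a I x := by
  refine hX.projParam_eq ha (ha.projParam_mem x) ⟨mem_image_of_mem a (ha.projParam_mem x), ?_⟩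
  rintro _ ⟨t, ht, rfl⟩
  have h1 := ha.dist_proj_le x ht
  have h2 := dist_triangle x z (a t)
  linarith

end Projection

/-! ### Segments and connectedness of projection slabs -/

section Segment

variable {X : Type*} [MetricSpace X] {γ : ℝ → X} {x y : X}

theorem IsSegment.isClosedGeodesic (h : IsSegment γ x y) : IsClosedGeodesic γ (Icc 0 (dist x y)) :=
  ⟨isClosed_Icc, ordConnected_Icc, nonempty_Icc.2 dist_nonneg, h.1⟩

theorem IsSegment.dist_left (h : IsSegment γ x y) {s : ℝ} (hs : s ∈ Icc 0 (dist x y)) :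
    dist x (γ s) = s := by
  have := h.1 0 ⟨le_rfl, dist_nonneg⟩ s hs
  rwa [h.2.1, zero_sub, abs_neg, abs_of_nonneg hs.1] at this

theorem IsSegment.dist_right (h : IsSegment γ x y) {s : ℝ} (hs : s ∈ Icc 0 (dist x y)) :
    dist (γ s) y = dist x y - s := by
  have := h.1 s hs (dist x y) ⟨dist_nonneg, le_rfl⟩
  rwa [h.2.2, abs_sub_comm, abs_of_nonneg (sub_nonneg.2 hs.2)] at this

theorem IsSegment.left_mem (h : IsSegment γ x y) : x ∈ γ '' Icc 0 (dist x y) :=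
  ⟨0, ⟨le_rfl, dist_nonneg⟩, h.2.1⟩

theorem IsSegment.right_mem (h : IsSegment γ x y) : y ∈ γ '' Icc 0 (dist x y) :=
  ⟨dist x y, ⟨dist_nonneg, le_rfl⟩, h.2.2⟩

theorem IsSegment.isPreconnected (h : IsSegment γ x y) :
    IsPreconnected (γ '' Icc 0 (dist x y)) :=
  isPreconnected_Icc.image _ h.1.continuousOn

theorem IsSegment.continuousOn (h : IsSegment γ x y) : ContinuousOn γ (Icc 0 (dist x y)) :=
  h.1.continuousOn

/-- A segment from `x` to its projection consists of points with the same projection. -/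
theorem IsCAT0.projParam_of_mem_segment (hX : IsCAT0 X) {a : ℝ → X} {I : Set ℝ}
    (ha : IsClosedGeodesic a I) (h : IsSegment γ x (a (projParam a I x))) {z : X}
    (hz : z ∈ γ '' Icc 0 (dist x (a (projParam a I x)))) : projParam a I z = projParam a I x := by
  obtain ⟨s, hs, rfl⟩ := hz
  refine hX.projParam_eq_of_dist_add ha ?_
  rw [h.dist_left hs, h.dist_right hs]; ring

/-- The set of points projecting to a subinterval of a geodesic is connected. -/
theorem IsCAT0.isPreconnected_projParam_preimage (hX : IsCAT0 X) {a : ℝ → X} {I : Set ℝ}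
    (ha : IsClosedGeodesic a I) {J : Set ℝ} (hJ : J.OrdConnected) :
    IsPreconnected {x | projParam a I x ∈ J} := by
  rcases {x | projParam a I x ∈ J}.eq_empty_or_nonempty with h | ⟨x₀, hx₀⟩
  · rw [h]; exact isPreconnected_empty
  -- Each point is joined to its foot by a segment inside its own fibre; the feet lie on the
  -- connected arc `a '' (J ∩ I)`.
  have hstar : ∀ x ∈ {x | projParam a I x ∈ J}, ∃ t ⊆ {x | projParam a I x ∈ J},
      x ∈ t ∧ a (projParam a I x) ∈ t ∧ IsPreconnected t := by
    intro x hx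
    obtain ⟨γ, hγ⟩ := hX.exists_segment x (a (projParam a I x))
    refine ⟨_, fun z hz => ?_, hγ.left_mem, hγ.right_mem, hγ.isPreconnected⟩
    simpa [hX.projParam_of_mem_segment ha hγ hz] using hx
  have hcore : IsPreconnected (a '' (J ∩ I)) :=
    (hJ.inter ha.ordConnected).isPreconnected.image _
      (ha.isGeodesicOn.continuousOn.mono inter_subset_right)
  have hsub : a '' (J ∩ I) ⊆ {x | projParam a I x ∈ J} := by
    rintro _ ⟨t, ht, rfl⟩
    simpa [hX.projParam_self ha ht.2] using ht.1
  obtain ⟨t₀, h1, h2, h3, h4⟩ := hstar x₀ hx₀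
  refine isPreconnected_of_forall x₀ fun y hy => ?_
  obtain ⟨t₁, k1, k2, k3, k4⟩ := hstar y hy
  have hmem : ∀ x ∈ {x | projParam a I x ∈ J}, a (projParam a I x) ∈ a '' (J ∩ I) :=
    fun x hx => mem_image_of_mem a ⟨hx, ha.projParam_mem x⟩
  have c1 := h4.union _ h3 (hmem x₀ hx₀) hcore
  refine ⟨_, union_subset (union_subset h1 hsub) k1, Or.inl (Or.inl h2), Or.inr k2,
    c1.union (a (projParam a I y)) (Or.inr (hmem y hy)) k3 k4⟩

end Segment

/-! ### Curtains as slabs of a 1-Lipschitz coordinate -/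

section Coordinates

variable {X : Type*} [MetricSpace X]

theorem IsCAT0.mem_projPreimage_iff (hX : IsCAT0 X) {a : ℝ → X} {I J : Set ℝ}
    (ha : IsClosedGeodesic a I) (hJ : J ⊆ I) {x : X} :
    x ∈ projPreimage (a '' I) (a '' J) ↔ projParam a I x ∈ J := by
  constructor
  · rintro ⟨_, ⟨t, ht, rfl⟩, hc⟩
    rwa [hX.projParam_eq ha (hJ ht) hc]
  · exact fun h => ⟨_, mem_image_of_mem a h, (ha.projParam_spec x).2⟩

namespace Curtain

variable (h : Curtain X)

theorem Icc_subset : Icc (h.r - 1 / 2) (h.r + 1 / 2) ⊆ h.I := h.pole_subset.trans interior_subset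

theorem r_mem : h.r ∈ h.I := h.Icc_subset ⟨by linarith, by linarith⟩

theorem isClosedGeodesic : IsClosedGeodesic h.path h.I :=
  ⟨h.isClosed_I, h.ordConnected_I, ⟨h.r, h.r_mem⟩, h.isGeodesicOn⟩

/-- The signed distance of the projection of `x` from the centre of the pole. -/
noncomputable def coord (x : X) : ℝ := projParam h.path h.I x - h.r

variable {h}

theorem mem_carrier_iff (hX : IsCAT0 X) {x : X} : x ∈ h.carrier ↔ |h.coord x| ≤ 1 / 2 := by
  rw [carrier, hX.mem_projPreimage_iff h.isClosedGeodesic h.Icc_subset, coord, abs_le, mem_Icc]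
  constructor <;> rintro ⟨h1, h2⟩ <;> constructor <;> linarith

theorem mem_neg_iff (hX : IsCAT0 X) {x : X} : x ∈ h.neg ↔ h.coord x < -(1 / 2) := by
  rw [neg, hX.mem_projPreimage_iff h.isClosedGeodesic inter_subset_left, coord, mem_inter_iff,
    mem_Iio, and_iff_right (h.isClosedGeodesic.projParam_mem x)]
  constructor <;> intro <;> linarith

theorem mem_pos_iff (hX : IsCAT0 X) {x : X} : x ∈ h.pos ↔ 1 / 2 < h.coord x := by
  rw [pos, hX.mem_projPreimage_iff h.isClosedGeodesic inter_subset_left, coord, mem_inter_iff,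
    mem_Ioi, and_iff_right (h.isClosedGeodesic.projParam_mem x)]
  constructor <;> intro <;> linarith

/-- `g` is the coordinate of the curtain `h`, up to sign. -/
def IsOrientation (h : Curtain X) (g : X → ℝ) : Prop :=
  g = h.coord ∨ g = fun x => -h.coord x

namespace IsOrientation

variable {g : X → ℝ}

theorem neg (hg : IsOrientation h g) : IsOrientation h (fun x => -g x) := by
  rcases hg with rfl | rfl
  · exact Or.inr rfl
  · left; simp

theorem mem_carrier_iff (hg : IsOrientation h g) (hX : IsCAT0 X) {x : X} :
    x ∈ h.carrier ↔ |g x| ≤ 1 / 2 := by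
  rw [Curtain.mem_carrier_iff hX]
  rcases hg with rfl | rfl <;> simp

theorem abs_sub_le (hg : IsOrientation h g) (hX : IsCAT0 X) (x y : X) :
    |g x - g y| ≤ dist x y := by
  have := hX.abs_projParam_sub_le h.isClosedGeodesic x y
  rcases hg with rfl | rfl
  · simpa [coord] using this
  · rw [abs_sub_comm] at this
    simpa [coord, add_comm, ← sub_eq_add_neg] using this

theorem continuous (hg : IsOrientation h g) (hX : IsCAT0 X) : Continuous g :=
  (LipschitzWith.of_dist_le_mul (K := 1) fun x y => by
    simpa [Real.dist_eq] using hg.abs_sub_le hX x y).continuous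

theorem isPreconnected_preimage (hg : IsOrientation h g) (hX : IsCAT0 X) {J : Set ℝ}
    (hJ : J.OrdConnected) : IsPreconnected {x | g x ∈ J} := by
  rcases hg with rfl | rfl
  · refine hX.isPreconnected_projParam_preimage h.isClosedGeodesic
      (J := (fun t => t - h.r) ⁻¹' J) (hJ.preimage_mono fun s t hst => ?_)
    simpa using hst
  · refine hX.isPreconnected_projParam_preimage h.isClosedGeodesic
      (J := (fun t => -(t - h.r)) ⁻¹' J) (hJ.preimage_anti fun s t hst => ?_)
    simpa only [neg_le_neg_iff, sub_le_sub_iff_right] using hst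

theorem separates_iff (hg : IsOrientation h g) (hX : IsCAT0 X) {A B : Set X} :
    h.Separates A B ↔ ((∀ x ∈ A, g x < -(1 / 2)) ∧ ∀ x ∈ B, 1 / 2 < g x) ∨
      ((∀ x ∈ A, 1 / 2 < g x) ∧ ∀ x ∈ B, g x < -(1 / 2)) := by
  have e1 : ∀ S : Set X, S ⊆ h.neg ↔ ∀ x ∈ S, h.coord x < -(1 / 2) := fun S =>
    forall₂_congr fun x _ => mem_neg_iff hX
  have e2 : ∀ S : Set X, S ⊆ h.pos ↔ ∀ x ∈ S, 1 / 2 < h.coord x := fun S =>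
    forall₂_congr fun x _ => mem_pos_iff hX
  rw [Separates, e1, e1, e2, e2]
  rcases hg with rfl | rfl
  · rfl
  · have e3 : ∀ x, -h.coord x < -(1 / 2) ↔ 1 / 2 < h.coord x := fun x => neg_lt_neg_iff
    have e4 : ∀ x, 1 / 2 < -h.coord x ↔ h.coord x < -(1 / 2) := fun x => lt_neg
    simp only [e3, e4]
    exact or_comm

end IsOrientation

theorem isPreconnected_carrier (hX : IsCAT0 X) : IsPreconnected h.carrier := by
  have : h.carrier = {x | h.coord x ∈ Icc (-(1 / 2)) (1 / 2)} := by
    ext x; rw [mem_carrier_iff hX, abs_le]; rfl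
  rw [this]
  exact IsOrientation.isPreconnected_preimage (Or.inl rfl) hX ordConnected_Icc

theorem carrier_nonempty (hX : IsCAT0 X) : h.carrier.Nonempty :=
  ⟨h.path h.r, by
    rw [mem_carrier_iff hX, coord, hX.projParam_self h.isClosedGeodesic h.r_mem]; norm_num⟩

/-- A curtain lies in a half space of any curtain disjoint from it. -/
theorem exists_orientation_of_disjoint (hX : IsCAT0 X) {k : Curtain X}
    (hd : Disjoint h.carrier k.carrier) :
    ∃ g, IsOrientation h g ∧ ∀ x ∈ k.carrier, 1 / 2 < g x := by
  obtain ⟨w, hw⟩ := k.carrier_nonempty hX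
  have hout : ∀ x ∈ k.carrier, 1 / 2 < |h.coord x| := fun x hx => by
    rw [← not_le, ← mem_carrier_iff hX]
    exact fun hx' => hd.le_bot ⟨hx', hx⟩
  obtain ⟨g, hg, hgw⟩ : ∃ g, IsOrientation h g ∧ 1 / 2 < g w := by
    rcases lt_abs.1 (hout w hw) with h1 | h1
    · exact ⟨_, Or.inl rfl, h1⟩
    · exact ⟨_, Or.inr rfl, h1⟩
  refine ⟨g, hg, fun x hx => ?_⟩
  by_contra! hle
  have hmem := (k.isPreconnected_carrier hX).intermediate_value hx hw
    (hg.continuous hX).continuousOn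
  obtain ⟨y, hy, hgy⟩ := hmem ⟨hle, hgw.le⟩
  refine hd.le_bot ⟨(hg.mem_carrier_iff hX).2 ?_, hy⟩
  rw [hgy]; norm_num

end Curtain

end Coordinates

/-! ### Nested half spaces of chains and distance bounds -/

section Chains

variable {X : Type*} [MetricSpace X] {n : ℕ} {c : Fin n → Curtain X}

/-- The curtains of a chain can be oriented so that their half spaces are nested. -/
theorem IsChainOfCurtains.exists_orientation (hX : IsCAT0 X) (hc : IsChainOfCurtains c) :
    ∃ g : Fin n → X → ℝ, (∀ i, (c i).IsOrientation (g i)) ∧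
      ∀ i j, i < j → ∀ x, g i x ≤ 1 / 2 → g j x < -(1 / 2) := by
  have hex : ∀ j, ∃ g, (c j).IsOrientation g ∧
      (∀ i : Fin n, (i : ℕ) + 1 = j → ∀ x ∈ (c i).carrier, g x < -(1 / 2)) ∧
      (∀ k : Fin n, (j : ℕ) + 1 = k → ∀ x ∈ (c k).carrier, 1 / 2 < g x) := by
    intro j
    by_cases hp : ∃ i : Fin n, (i : ℕ) + 1 = j <;> by_cases hs : ∃ k : Fin n, (j : ℕ) + 1 = k
    · obtain ⟨i, hi⟩ := hp
      obtain ⟨k, hk⟩ := hs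
      have hi' : ∀ i' : Fin n, (i' : ℕ) + 1 = j → i' = i := fun i' h => Fin.ext (by omega)
      have hk' : ∀ k' : Fin n, (j : ℕ) + 1 = k' → k' = k := fun k' h => Fin.ext (by omega)
      rcases (Curtain.IsOrientation.separates_iff (Or.inl rfl) hX).1 (hc.2 i j k hi hk) with h | h
      · exact ⟨_, Or.inl rfl, fun i' h' => hi' i' h' ▸ h.1, fun k' h' => hk' k' h' ▸ h.2⟩
      · refine ⟨_, Or.inr rfl, fun i' h' => hi' i' h' ▸ fun x hx => ?_,
          fun k' h' => hk' k' h' ▸ fun x hx => ?_⟩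
        · linarith [h.1 x hx]
        · linarith [h.2 x hx]
    · obtain ⟨i, hi⟩ := hp
      obtain ⟨g, hg, h⟩ := Curtain.exists_orientation_of_disjoint hX
        (hc.1 j i (by rintro rfl; omega))
      refine ⟨_, hg.neg, fun i' h' x hx => ?_, fun k hk => (hs ⟨k, hk⟩).elim⟩
      obtain rfl : i' = i := Fin.ext (by omega)
      linarith [h x hx]
    · obtain ⟨k, hk⟩ := hs
      obtain ⟨g, hg, h⟩ := Curtain.exists_orientation_of_disjoint hX
        (hc.1 j k (by rintro rfl; omega))
      refine ⟨_, hg, fun i hi => (hp ⟨i, hi⟩).elim, fun k' h' x hx => ?_⟩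
      obtain rfl : k' = k := Fin.ext (by omega)
      exact h x hx
    · exact ⟨_, Or.inl rfl, fun i hi => (hp ⟨i, hi⟩).elim, fun k hk => (hs ⟨k, hk⟩).elim⟩
  choose g hg hpred hsucc using hex
  -- The half space `g i ≤ 1 / 2` is connected and contains the curtain `c i`, which lies before `c
  -- j`. If it reached `-1 / 2` in the coordinate of `c j`, it would contain a point of `c j`; but
  -- `c j` lies beyond `c i`.
  have hstep : ∀ i j : Fin n, (i : ℕ) + 1 = j → ∀ x, g i x ≤ 1 / 2 → g j x < -(1 / 2) := by
    intro i j hij x hx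
    by_contra! hle
    obtain ⟨w, hw⟩ := (c i).carrier_nonempty hX
    have hconn := (hg i).isPreconnected_preimage hX (ordConnected_Iic (a := (1 / 2 : ℝ)))
    obtain ⟨y, hy, hgy⟩ := hconn.intermediate_value
      (abs_le.1 (((hg i).mem_carrier_iff hX).1 hw)).2 hx ((hg j).continuous hX).continuousOn
      ⟨(hpred j i hij w hw).le, hle⟩
    have hyc : y ∈ (c j).carrier := ((hg j).mem_carrier_iff hX).2 (by rw [hgy]; norm_num)
    exact absurd (hsucc i j hij y hyc) (not_lt.2 hy)
  refine ⟨g, hg, ?_⟩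
  have hind : ∀ m : ℕ, ∀ i j : Fin n, (i : ℕ) + 1 + m = j →
      ∀ x, g i x ≤ 1 / 2 → g j x < -(1 / 2) := by
    intro m
    induction m with
    | zero => exact fun i j hij => hstep i j hij
    | succ m ih =>
      intro i j hij x hx
      have hlt : (i : ℕ) + 1 + m < n := by have := j.2; omega
      refine hstep ⟨i + 1 + m, hlt⟩ j (by simp; omega) x ?_
      have := ih i ⟨i + 1 + m, hlt⟩ rfl x hx
      linarith
  intro i j hij
  exact hind (j - i - 1) i j (by have : (i : ℕ) < j := hij; omega)

/-- Each of the `m + 1` curtains between `x` and `y` costs length 1. The segment is cut where it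
enters the last curtain: that point is already past the previous one, so the rest follows by
induction. -/
theorem le_dist_of_nested (hX : IsCAT0 X) {g : Fin n → X → ℝ}
    (hg : ∀ i, (c i).IsOrientation (g i))
    (hlt : ∀ i j, i < j → ∀ x, g i x ≤ 1 / 2 → g j x < -(1 / 2)) {x : X} (m : ℕ) :
    ∀ i j : Fin n, (i : ℕ) + m = j → ∀ y, g i x ≤ -(1 / 2) → 1 / 2 ≤ g j y →
      (m : ℝ) + 1 ≤ dist x y := by
  induction m with
  | zero =>
    intro i j hij y hx hy
    obtain rfl : i = j := Fin.ext (by simpa using hij)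
    have := (abs_le.1 ((hg i).abs_sub_le hX x y)).1
    push_cast; linarith
  | succ m ih =>
    intro i j hij y hx hy
    have hm : (i : ℕ) + m < n := by have := j.2; omega
    have hij' : i < j := by rw [Fin.lt_def]; omega
    have hkj : (⟨i + m, hm⟩ : Fin n) < j := by rw [Fin.lt_def]; simp; omega
    obtain ⟨γ, hγ⟩ := hX.exists_segment x y
    obtain ⟨_, ⟨s, hs, rfl⟩, hgs⟩ := hγ.isPreconnected.intermediate_value hγ.left_mem
      hγ.right_mem ((hg j).continuous hX).continuousOn
      (⟨(hlt i j hij' x (by linarith)).le, by linarith⟩ : -(1 / 2) ∈ Icc (g j x) (g j y))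
    have h1 : 1 / 2 ≤ g ⟨i + m, hm⟩ (γ s) := by
      by_contra! hle
      have := hlt _ _ hkj (γ s) hle.le
      linarith
    have h2 := ih i ⟨i + m, hm⟩ rfl (γ s) hx h1
    have h3 := (abs_le.1 ((hg j).abs_sub_le hX (γ s) y)).1
    rw [hγ.dist_left hs] at h2
    rw [hγ.dist_right hs] at h3
    push_cast; linarith

/-- Points of two members of a chain are at least as far apart as there are members between. -/
theorem IsChainOfCurtains.le_dist (hX : IsCAT0 X) (hc : IsChainOfCurtains c) {i j : Fin n}
    {m : ℕ} (hij : (i : ℕ) + m + 1 = j) {z w : X} (hz : z ∈ (c i).carrier)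
    (hw : w ∈ (c j).carrier) : (m : ℝ) ≤ dist z w := by
  obtain ⟨g, hg, hlt⟩ := hc.exists_orientation hX
  rcases m with _ | m
  · simp
  have hj := j.2
  have h1 : (i : ℕ) + 1 < n := by omega
  have h2 : (i : ℕ) + 1 + m < n := by omega
  have e1 := hlt i ⟨i + 1, h1⟩ (by simp [Fin.lt_def]) z
    (abs_le.1 (((hg i).mem_carrier_iff hX).1 hz)).2
  have e2 : 1 / 2 ≤ g ⟨i + 1 + m, h2⟩ w := by
    by_contra! hle
    have := hlt _ j (by rw [Fin.lt_def]; simp; omega) w hle.le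
    linarith [(abs_le.1 (((hg j).mem_carrier_iff hX).1 hw)).1]
  exact_mod_cast le_dist_of_nested hX hg hlt m ⟨i + 1, h1⟩ ⟨i + 1 + m, h2⟩ rfl w e1.le e2

/-- A chain separating `x` from `y` has nested orientations for which `x` and `y` lie in opposite
half spaces, in one of the two orders. -/
theorem IsChainOfCurtains.exists_orientation_of_separates (hX : IsCAT0 X)
    (hc : IsChainOfCurtains c) {x y : X} (hs : ∀ i, (c i).Separates {x} {y}) :
    ∃ g : Fin n → X → ℝ, (∀ i, (c i).IsOrientation (g i)) ∧
      (∀ i j, i < j → ∀ x, g i x ≤ 1 / 2 → g j x < -(1 / 2)) ∧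
      ((∀ i, g i x < -(1 / 2) ∧ 1 / 2 < g i y) ∨ (∀ i, g i y < -(1 / 2) ∧ 1 / 2 < g i x)) := by
  obtain ⟨g, hg, hlt⟩ := hc.exists_orientation hX
  refine ⟨g, hg, hlt, ?_⟩
  rcases n with _ | n
  · exact Or.inl fun i => i.elim0
  have hs' : ∀ i, (g i x < -(1 / 2) ∧ 1 / 2 < g i y) ∨ (1 / 2 < g i x ∧ g i y < -(1 / 2)) :=
    fun i => by simpa using ((hg i).separates_iff hX).1 (hs i)
  rcases hs' 0 with h0 | h0
  · refine Or.inl fun i => ?_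
    rcases (Fin.zero_le i).eq_or_lt with rfl | hi
    · exact h0
    · have := hlt 0 i hi x (by linarith)
      rcases hs' i with h | h
      · exact h
      · linarith
  · refine Or.inr fun i => ?_
    rcases (Fin.zero_le i).eq_or_lt with rfl | hi
    · exact h0.symm
    · have := hlt 0 i hi y (by linarith)
      rcases hs' i with h | h
      · linarith
      · exact h.symm

theorem IsChainOfCurtains.card_le_dist (hX : IsCAT0 X)
    (hc : IsChainOfCurtains c) {x y : X} (hs : ∀ i, (c i).Separates {x} {y}) :
    (n : ℝ) ≤ dist x y := by
  obtain ⟨g, hg, hlt, h⟩ := hc.exists_orientation_of_separates hX hs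
  rcases n with _ | n
  · simp
  push_cast
  rcases h with h | h
  · exact le_dist_of_nested hX hg hlt n 0 (Fin.last n) (by simp) y (h 0).1.le (h _).2.le
  · rw [dist_comm]
    exact le_dist_of_nested hX hg hlt n 0 (Fin.last n) (by simp) x (h 0).1.le (h _).2.le

/-- A point of a member of a chain separating `x` from `y` is far from `x` and from `y` if the
member is far from both ends of the chain. -/
theorem IsChainOfCurtains.le_dist_of_separates (hX : IsCAT0 X)
    (hc : IsChainOfCurtains c) {x y : X} (hs : ∀ i, (c i).Separates {x} {y}) {i : Fin n} {m : ℕ}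
    (h₁ : m ≤ (i : ℕ)) (h₂ : (i : ℕ) + m < n) {z : X} (hz : z ∈ (c i).carrier) :
    (m : ℝ) ≤ dist x z ∧ (m : ℝ) ≤ dist y z := by
  rcases m with _ | m
  · simp
  obtain ⟨g, hg, hlt, h⟩ := hc.exists_orientation_of_separates hX hs
  have hi := i.2
  have hz' := abs_le.1 (((hg i).mem_carrier_iff hX).1 hz)
  have k1 : (i : ℕ) - 1 < n := by omega
  have k2 : (i : ℕ) - 1 - m < n := by omega
  have k3 : (i : ℕ) + 1 < n := by omega
  have k4 : (i : ℕ) + 1 + m < n := by omega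
  have e1 : 1 / 2 ≤ g ⟨i - 1, k1⟩ z := by
    by_contra! hle
    have := hlt _ i (by rw [Fin.lt_def]; simp; omega) z hle.le
    linarith
  have e2 := hlt i ⟨i + 1, k3⟩ (by simp [Fin.lt_def]) z hz'.2
  have f1 := fun w hw => le_dist_of_nested hX hg hlt (x := w) m ⟨i - 1 - m, k2⟩ ⟨i - 1, k1⟩
    (by simp; omega) z hw e1
  have f2 := fun w hw => le_dist_of_nested hX hg hlt (x := z) m ⟨i + 1, k3⟩ ⟨i + 1 + m, k4⟩
    rfl w e2.le hw
  push_cast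
  rcases h with h | h
  · exact ⟨f1 x (h _).1.le, dist_comm z y ▸ f2 y (h _).2.le⟩
  · exact ⟨dist_comm z x ▸ f2 x (h _).2.le, f1 y (h _).1.le⟩

end Chains

/-! ### Curtains dual to a geodesic -/

section DualChains

variable {X : Type*} [MetricSpace X] {a : ℝ → X} {I : Set ℝ}

/-- Evenly spaced curtains dual to a geodesic. -/
theorem IsCAT0.exists_dual_curtains (hX : IsCAT0 X) (ha : IsClosedGeodesic a I) {u M : ℝ}
    (hM : 1 < M) {n : ℕ} (hI : Ioo u (u + M * n) ⊆ I) :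
    ∃ c : Fin n → Curtain X, IsChainOfCurtains c ∧
      ∀ (j : Fin n) (x : X), (c j).coord x = projParam a I x - (u + M * (j + 1 / 2)) := by
  have hpole : ∀ j : Fin n, Icc (u + M * (j + 1 / 2) - 1 / 2) (u + M * (j + 1 / 2) + 1 / 2) ⊆
      interior I := by
    intro j t ht
    refine interior_maximal hI isOpen_Ioo ⟨?_, ?_⟩
    · have : 0 ≤ M * (j : ℕ) := by positivity
      linarith [ht.1]
    · have : ((j : ℕ) : ℝ) + 1 ≤ n := by exact_mod_cast j.2
      have := mul_le_mul_of_nonneg_left this (by linarith : 0 ≤ M)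
      linarith [ht.2]
  -- The poles are centred in the `n` cells of length `M` of the interval; `M > 1` makes them
  -- disjoint.
  let c : Fin n → Curtain X := fun j =>
    ⟨I, ha.isClosed, ha.ordConnected, a, ha.isGeodesicOn, u + M * (j + 1 / 2), hpole j⟩
  have hcoord : ∀ (j : Fin n) (x : X),
      (c j).coord x = projParam a I x - (u + M * (j + 1 / 2)) := fun _ _ => rfl
  have hgap : ∀ i j : Fin n, (i : ℕ) < j → M * (i : ℕ) + 1 < M * (j : ℕ) := by
    intro i j hij
    have : ((i : ℕ) : ℝ) + 1 ≤ (j : ℕ) := by exact_mod_cast hij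
    have := mul_le_mul_of_nonneg_left this (by linarith : 0 ≤ M)
    linarith
  have hbefore : ∀ i j : Fin n, (i : ℕ) < j → ∀ x ∈ (c i).carrier, (c j).coord x < -(1 / 2) := by
    intro i j hij x hx
    have := (abs_le.1 ((Curtain.mem_carrier_iff hX).1 hx)).2
    rw [hcoord] at this ⊢
    linarith [hgap i j hij]
  have hafter : ∀ i j : Fin n, (i : ℕ) < j → ∀ x ∈ (c j).carrier, 1 / 2 < (c i).coord x := by
    intro i j hij x hx
    have := (abs_le.1 ((Curtain.mem_carrier_iff hX).1 hx)).1
    rw [hcoord] at this ⊢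
    linarith [hgap i j hij]
  refine ⟨c, ⟨fun i j hij => ?_, fun i j k hij hjk => ?_⟩, hcoord⟩
  · rw [Set.disjoint_left]
    intro x hxi hxj
    have h2 := abs_le.1 ((Curtain.mem_carrier_iff hX).1 hxj)
    rcases lt_or_gt_of_ne (fun h => hij (Fin.ext h) : (i : ℕ) ≠ j) with h | h
    · linarith [hbefore i j h x hxi]
    · linarith [hafter j i h x hxi]
  · rw [Curtain.IsOrientation.separates_iff (Or.inl rfl) hX]
    exact Or.inl ⟨hbefore i j (by omega), hafter j k (by omega)⟩

/-- If two `N`-separated curtains both cross a stretch of a geodesic, the stretch is short. -/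
theorem IsLSeparated.sub_le (hX : IsCAT0 X) (ha : IsClosedGeodesic a I) {N : ℕ}
    {h k : Curtain X} (hhk : IsLSeparated N h k) {r s : ℝ} {x y x' y' : X}
    (hx : x ∈ h.carrier) (hy : y ∈ h.carrier) (hx' : x' ∈ k.carrier) (hy' : y' ∈ k.carrier)
    (hxr : projParam a I x ≤ r) (hys : s ≤ projParam a I y)
    (hxr' : projParam a I x' ≤ r) (hys' : s ≤ projParam a I y') : s - r ≤ N + 1 := by
  by_contra! hlt
  -- With this spacing `N + 1` dual curtains fill the stretch. Each meets both connected carriers,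
  -- one more than separation allows.
  set M : ℝ := (s - r) / (N + 1) with hMdef
  have hM : 1 < M := by rw [hMdef, lt_div_iff₀ (by positivity)]; linarith
  have hMN : M * ((N + 1 : ℕ) : ℝ) = s - r := by rw [hMdef]; push_cast; field_simp
  obtain ⟨c, hc, hcoord⟩ := hX.exists_dual_curtains ha (u := r) hM (n := N + 1) fun t ht => by
    rw [hMN] at ht
    exact ha.ordConnected.out (ha.projParam_mem x) (ha.projParam_mem y)
      ⟨by linarith [ht.1], by linarith [ht.2]⟩
  have hmeets : ∀ (l : Curtain X) (v w : X), v ∈ l.carrier → w ∈ l.carrier →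
      projParam a I v ≤ r → s ≤ projParam a I w → ∀ i, (c i).Meets l := by
    intro l v w hv hw hvr hws i
    have h1 : (0 : ℝ) ≤ M * (i : ℕ) := by positivity
    have h2 : M * ((i : ℕ) + 1) ≤ M * ((N + 1 : ℕ) : ℝ) := by
      have : ((i : ℕ) : ℝ) + 1 ≤ ((N + 1 : ℕ) : ℝ) := by exact_mod_cast i.2
      exact mul_le_mul_of_nonneg_left this (by linarith)
    have hcont : Continuous (c i).coord :=
      Curtain.IsOrientation.continuous (Or.inl rfl) hX
    obtain ⟨z, hz, hz0⟩ := (l.isPreconnected_carrier hX).intermediate_value hv hw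
      hcont.continuousOn (⟨by rw [hcoord]; linarith, by rw [hcoord]; linarith⟩ :
        (0 : ℝ) ∈ Icc ((c i).coord v) ((c i).coord w))
    exact ⟨z, (Curtain.mem_carrier_iff hX).2 (by rw [hz0]; norm_num), hz⟩
  have := hhk.2 (N + 1) c hc fun i =>
    ⟨hmeets h x y hx hy hxr hys i, hmeets k x' y' hx' hy' hxr' hys' i⟩
  omega

end DualChains

/-! ### Chains separating the feet of two nearby points -/

section LongChains

variable {X : Type*} [MetricSpace X]

theorem Curtain.Separates.symm {h : Curtain X} {A B : Set X} (hs : h.Separates A B) :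
    h.Separates B A := by
  rcases hs with ⟨h1, h2⟩ | ⟨h1, h2⟩
  · exact Or.inr ⟨h2, h1⟩
  · exact Or.inl ⟨h2, h1⟩

theorem IsLSeparated.symm {N : ℕ} {h k : Curtain X} (hs : IsLSeparated N h k) :
    IsLSeparated N k h :=
  ⟨hs.1.symm, fun n c hc hm => hs.2 n c hc fun i => (hm i).symm⟩

theorem Curtain.Separates.exists_orientation (hX : IsCAT0 X) {h : Curtain X} {x y : X}
    (hs : h.Separates {x} {y}) : ∃ g, h.IsOrientation g ∧ g x < -(1 / 2) ∧ 1 / 2 < g y := by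
  rcases (Curtain.IsOrientation.separates_iff (Or.inl rfl) hX).1 hs with h1 | h1
  · exact ⟨_, Or.inl rfl, by simpa using h1⟩
  · refine ⟨_, Or.inr rfl, ?_, ?_⟩
    · have := h1.1 x rfl; linarith
    · have := h1.2 y rfl; linarith

theorem Curtain.IsOrientation.exists_mem_carrier (hX : IsCAT0 X) {h : Curtain X} {g : X → ℝ}
    (hg : h.IsOrientation g) {S : Set X} (hS : IsPreconnected S) {x y : X} (hx : x ∈ S)
    (hy : y ∈ S) (hgx : g x ≤ 0) (hgy : 0 ≤ g y) : ∃ z ∈ S, z ∈ h.carrier := by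
  obtain ⟨z, hz, hz0⟩ := hS.intermediate_value hx hy (hg.continuous hX).continuousOn ⟨hgx, hgy⟩
  exact ⟨z, hz, (hg.mem_carrier_iff hX).2 (by rw [hz0]; norm_num)⟩

/-- Two separated curtains which cross a geodesic far from `p`, on the same side, do not both
meet the fibre of the projection over `p`. -/
theorem IsLSeparated.false_of_fibre (hX : IsCAT0 X) {a : ℝ → X} {I : Set ℝ}
    (ha : IsClosedGeodesic a I) {N : ℕ} {h k : Curtain X} (hhk : IsLSeparated N h k)
    {p u u' : ℝ} {z z' : X} (hu : u ∈ I) (hu' : u' ∈ I) (hz : z ∈ h.carrier)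
    (hz' : z' ∈ k.carrier) (huh : a u ∈ h.carrier) (huk : a u' ∈ k.carrier)
    (hzp : projParam a I z = p) (hzp' : projParam a I z' = p)
    (hfar : (p + (N + 2) ≤ u ∧ p + (N + 2) ≤ u') ∨ (u + (N + 2) ≤ p ∧ u' + (N + 2) ≤ p)) :
    False := by
  have e := hX.projParam_self ha hu
  have e' := hX.projParam_self ha hu'
  rcases hfar with ⟨h1, h2⟩ | ⟨h1, h2⟩
  · have := hhk.sub_le hX ha (r := p) (s := p + (N + 2)) hz huh hz' huk hzp.le (by rwa [e])
      hzp'.le (by rwa [e'])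
    linarith
  · have := hhk.sub_le hX ha (r := p - (N + 2)) (s := p) huh hz huk hz' (by rw [e]; linarith)
      hzp.ge (by rw [e']; linarith) hzp'.ge
    linarith

/-- Among four consecutive indices, at most one of which satisfies `E` and at most one `F`, two
satisfy `P`. -/
theorem exists_pair_of_four {n k : ℕ} (hk : k + 3 < n) {E F P : Fin n → Prop}
    (hcov : ∀ i : Fin n, k ≤ i → (i : ℕ) ≤ k + 3 → E i ∨ P i ∨ F i)
    (hE : ∀ i j : Fin n, k ≤ i → (i : ℕ) ≤ k + 3 → k ≤ j → (j : ℕ) ≤ k + 3 → i ≠ j →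
      E i → E j → False)
    (hF : ∀ i j : Fin n, k ≤ i → (i : ℕ) ≤ k + 3 → k ≤ j → (j : ℕ) ≤ k + 3 → i ≠ j →
      F i → F j → False) :
    ∃ i j : Fin n, k ≤ i ∧ (i : ℕ) ≤ k + 3 ∧ k ≤ j ∧ (j : ℕ) ≤ k + 3 ∧ i ≠ j ∧ P i ∧ P j := by
  by_contra! hno
  have hP : ∀ i j : Fin n, k ≤ i → (i : ℕ) ≤ k + 3 → k ≤ j → (j : ℕ) ≤ k + 3 → i ≠ j →
      P i → P j → False := fun i j h1 h2 h3 h4 h5 h6 => hno i j h1 h2 h3 h4 h5 h6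
  have key : ∀ Q : Fin n → Prop, (∀ i j : Fin n, k ≤ i → (i : ℕ) ≤ k + 3 → k ≤ j →
      (j : ℕ) ≤ k + 3 → i ≠ j → Q i → Q j → False) →
      ∀ i j : Fin 4, i ≠ j → Q ⟨k + i, by omega⟩ → Q ⟨k + j, by omega⟩ → False := by
    intro Q hQ i j hij
    exact hQ _ _ (by simp) (by simp; omega) (by simp) (by simp; omega)
      (by simpa [Fin.ext_iff] using hij)
  have hcov' : ∀ i : Fin 4, ∃ m : Fin 3, (![E, P, F] m) ⟨k + i, by omega⟩ := by
    intro i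
    rcases hcov ⟨k + i, by omega⟩ (by simp) (by simp; omega) with h | h | h
    · exact ⟨0, h⟩
    · exact ⟨1, h⟩
    · exact ⟨2, h⟩
  choose m hm using hcov'
  obtain ⟨i, j, hij, hmij⟩ := Fintype.exists_ne_map_eq_of_card_lt m (by simp)
  have h1 := hm i
  have h2 := hm j
  rw [← hmij] at h2
  generalize m i = l at h1 h2
  fin_cases l
  · exact key E hE i j hij h1 h2
  · exact key P hP i j hij h1 h2
  · exact key F hF i j hij h1 h2

/-- If the ball around `x` through `y` does not reach the geodesic `a`, then long `N`-chains do not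
separate the projections of `x` and `y` to `a`. -/
theorem IsLChain.card_lt_of_dist_lt (hX : IsCAT0 X) {a : ℝ → X} {I : Set ℝ}
    (ha : IsClosedGeodesic a I) {N n : ℕ} {c : Fin n → Curtain X} (hc : IsLChain N c) {x y : X}
    (hs : ∀ i, (c i).Separates {a (projParam a I x)} {a (projParam a I y)})
    (hxy : dist x y < dist x (a (projParam a I x))) : n < 3 * N + 14 := by
  by_contra! hn
  set p := projParam a I x with hp
  set q := projParam a I y with hq
  have hpI : p ∈ I := ha.projParam_mem x
  have hqI : q ∈ I := ha.projParam_mem y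
  obtain ⟨e, he⟩ := hX.exists_segment x (a p)
  obtain ⟨α, hα⟩ := hX.exists_segment x y
  obtain ⟨f, hf⟩ := hX.exists_segment y (a q)
  have heproj : ∀ z ∈ e '' Icc 0 (dist x (a p)), projParam a I z = p := fun z hz =>
    hX.projParam_of_mem_segment ha he hz
  have hfproj : ∀ z ∈ f '' Icc 0 (dist y (a q)), projParam a I z = q := fun z hz =>
    hX.projParam_of_mem_segment ha hf hz
  have hpqI : uIcc p q ⊆ I := ha.ordConnected.uIcc_subset hpI hqI
  have hcross : ∀ i, ∃ u ∈ uIcc p q, a u ∈ (c i).carrier := by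
    intro i
    obtain ⟨g, hg, h1, h2⟩ := (hs i).exists_orientation hX
    obtain ⟨_, ⟨u, hu, rfl⟩, hz⟩ := hg.exists_mem_carrier hX
      (isPreconnected_uIcc.image a (ha.isGeodesicOn.continuousOn.mono hpqI))
      (mem_image_of_mem a left_mem_uIcc) (mem_image_of_mem a right_mem_uIcc)
      (by linarith) (by linarith)
    exact ⟨u, hu, hz⟩
  choose u hu huc using hcross
  -- Members at least `N + 2` places from both ends of the chain cross `a` at distance at least `N +
  -- 2` from both feet.
  have hfar : ∀ i : Fin n, N + 2 ≤ (i : ℕ) → (i : ℕ) + (N + 2) < n →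
      (p + (N + 2) ≤ u i ∧ u i + (N + 2) ≤ q) ∨ (q + (N + 2) ≤ u i ∧ u i + (N + 2) ≤ p) := by
    intro i h1 h2
    obtain ⟨d1, d2⟩ := hc.1.le_dist_of_separates hX hs h1 h2 (huc i)
    rw [ha.isGeodesicOn _ hpI _ (hpqI (hu i))] at d1
    rw [ha.isGeodesicOn _ hqI _ (hpqI (hu i))] at d2
    push_cast at d1 d2
    rcases le_total p q with hle | hle
    · rw [uIcc_of_le hle] at hu
      rw [abs_sub_comm, abs_of_nonneg (sub_nonneg.2 (hu i).1)] at d1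
      rw [abs_of_nonneg (sub_nonneg.2 (hu i).2)] at d2
      left; constructor <;> linarith
    · rw [uIcc_of_ge hle] at hu
      rw [abs_of_nonneg (sub_nonneg.2 (hu i).2)] at d1
      rw [abs_sub_comm, abs_of_nonneg (sub_nonneg.2 (hu i).1)] at d2
      right; constructor <;> linarith
  -- The path `a p`, `x`, `y`, `a q` joins the two sides of each curtain, so one of its three
  -- segments meets it.
  have hcov : ∀ i, (∃ z ∈ e '' Icc 0 (dist x (a p)), z ∈ (c i).carrier) ∨
      (∃ z ∈ α '' Icc 0 (dist x y), z ∈ (c i).carrier) ∨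
      (∃ z ∈ f '' Icc 0 (dist y (a q)), z ∈ (c i).carrier) := by
    intro i
    obtain ⟨g, hg, h1, h2⟩ := (hs i).exists_orientation hX
    rcases le_total 0 (g x) with hx | hx
    · exact Or.inl (hg.exists_mem_carrier hX he.isPreconnected he.right_mem he.left_mem
        (by linarith) hx)
    rcases le_total 0 (g y) with hy | hy
    · exact Or.inr (Or.inl (hg.exists_mem_carrier hX hα.isPreconnected hα.left_mem hα.right_mem
        hx hy))
    · exact Or.inr (Or.inr (hg.exists_mem_carrier hX hf.isPreconnected hf.left_mem hf.right_mem
        hy (by linarith)))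
  -- The outer segments `e` and `f` lie in the fibres over `p` and `q`, so neither can meet two of
  -- the middle curtains.
  have hEF : ∀ i j : Fin n, N + 2 ≤ (i : ℕ) → (i : ℕ) + (N + 2) < n → N + 2 ≤ (j : ℕ) →
      (j : ℕ) + (N + 2) < n → i ≠ j → ∀ z ∈ (c i).carrier, ∀ z' ∈ (c j).carrier,
      ((projParam a I z = p ∧ projParam a I z' = p) ∨
        (projParam a I z = q ∧ projParam a I z' = q)) → False := by
    intro i j hi hi' hj hj' hij z hz z' hz' hproj
    have fi := hfar i hi hi'
    have fj := hfar j hj hj'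
    have hN : (0 : ℝ) ≤ N := Nat.cast_nonneg N
    rcases hproj with ⟨e1, e2⟩ | ⟨e1, e2⟩ <;>
    · refine (hc.2 i j hij).false_of_fibre hX ha (hpqI (hu i)) (hpqI (hu j)) hz hz' (huc i)
        (huc j) e1 e2 ?_
      rcases fi with fi | fi <;> rcases fj with fj | fj
      · first | exact Or.inl ⟨fi.1, fj.1⟩ | exact Or.inr ⟨fi.2, fj.2⟩
      · linarith [fi.1, fi.2, fj.1, fj.2]
      · linarith [fi.1, fi.2, fj.1, fj.2]
      · first | exact Or.inr ⟨fi.2, fj.2⟩ | exact Or.inl ⟨fi.1, fj.1⟩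
  -- All of `a` projects to the end `a p` of `e`: as `e` lies in the fibre over `p`, the Lipschitz
  -- property gives distance at least `|u - p|` from `a u` to `e`.
  have hefoot : ∀ u ∈ I, projParam e (Icc 0 (dist x (a p))) (a u) = dist x (a p) := by
    intro u hu
    refine hX.projParam_eq he.isClosedGeodesic ⟨dist_nonneg, le_rfl⟩
      ⟨by rw [he.2.2]; exact he.right_mem, fun z hz => ?_⟩
    have h1 := hX.abs_projParam_sub_le ha (a u) z
    rwa [heproj z hz, hX.projParam_self ha hu, ← ha.isGeodesicOn _ hu _ hpI, ← he.2.2] at h1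
  have hwin : ∀ k : ℕ, N + 2 ≤ k → k + 3 + (N + 2) < n → ∃ l : Fin n, k ≤ (l : ℕ) ∧
      (l : ℕ) ≤ k + 3 ∧ ∃ s ∈ Icc 0 (dist x y), α s ∈ (c l).carrier ∧
        dist x (a p) - (N + 1) ≤ s := by
    intro k hk1 hk2
    obtain ⟨i, j, hi, hi', hj, hj', hij, ⟨_, ⟨s, hs1, rfl⟩, hs2⟩, ⟨_, ⟨t, ht1, rfl⟩, ht2⟩⟩ :=
      exists_pair_of_four (k := k) (by omega) (fun i _ _ => hcov i)
      (fun i j h1 h2 h3 h4 hij ⟨z, hz, hzi⟩ ⟨z', hz', hzj⟩ =>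
        hEF i j (by omega) (by omega) (by omega) (by omega) hij z hzi z' hzj
          (Or.inl ⟨heproj z hz, heproj z' hz'⟩))
      (fun i j h1 h2 h3 h4 hij ⟨z, hz, hzi⟩ ⟨z', hz', hzj⟩ =>
        hEF i j (by omega) (by omega) (by omega) (by omega) hij z hzi z' hzj
          (Or.inr ⟨hfproj z hz, hfproj z' hz'⟩))
    have hx0 : projParam e (Icc 0 (dist x (a p))) x = 0 := by
      have := hX.projParam_self he.isClosedGeodesic (t := 0) ⟨le_rfl, dist_nonneg⟩
      rwa [he.2.1] at this
    have hlow : ∀ s ∈ Icc 0 (dist x y), projParam e (Icc 0 (dist x (a p))) (α s) ≤ s := by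
      intro s hs
      have := hX.abs_projParam_sub_le he.isClosedGeodesic (α s) x
      rw [hx0, sub_zero, dist_comm (α s), hα.dist_left hs] at this
      exact (le_abs_self _).trans this
    by_contra! hno
    have h1 := (hlow s hs1).trans_lt (hno i hi hi' s hs1 hs2)
    have h2 := (hlow t ht1).trans_lt (hno j hj hj' t ht1 ht2)
    -- Seen from `e`, both curtains run from `α s` and `α t`, with coordinates at most `s` and `t`,
    -- to the far end of `e`. Separation therefore forces one of `s`, `t` to be large.
    have h3 := (hc.2 i j hij).sub_le hX he.isClosedGeodesic
      (r := max (projParam e (Icc 0 (dist x (a p))) (α s))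
        (projParam e (Icc 0 (dist x (a p))) (α t))) (s := dist x (a p)) hs2 (huc i) ht2 (huc j)
      (le_max_left _ _) (hefoot _ (hpqI (hu i))).ge (le_max_right _ _)
      (hefoot _ (hpqI (hu j))).ge
    have h4 := max_lt h1 h2
    linarith
  -- The windows start at `N + 2` and `2N + 8`, so at least `N + 2` curtains lie strictly between
  -- the two chosen ones. Both crossings are in the part of `α` from `dist x (a p) - (N + 1)` on,
  -- which is shorter than `N + 1`. The second window and the margin `N + 2` need `3N + 14` members.
  obtain ⟨l, hl, hl', s, hs1, hs2, hs3⟩ := hwin (N + 2) le_rfl (by omega)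
  obtain ⟨m, hm, hm', t, ht1, ht2, ht3⟩ := hwin (2 * N + 8) (by omega) (by omega)
  have hd := hc.1.le_dist hX (i := l) (j := m) (m := m - l - 1) (by omega) hs2 ht2
  have hd' : ((N + 2 : ℕ) : ℝ) ≤ ((m - l - 1 : ℕ) : ℝ) := by
    exact_mod_cast (by omega : N + 2 ≤ (m : ℕ) - l - 1)
  rw [hα.1 s hs1 t ht1] at hd
  push_cast at hd'
  rcases abs_cases (s - t) with ⟨h1, _⟩ | ⟨h1, _⟩
  · linarith [hs1.2]
  · linarith [ht1.2]

end LongChains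

/-! ### Upper bound for the curtain model metric -/

section CurtainModel

variable {X : Type*} [MetricSpace X]

theorem IsLSeparated.mono {L N : ℕ} (hLN : L ≤ N) {h k : Curtain X} (hs : IsLSeparated L h k) :
    IsLSeparated N h k :=
  ⟨hs.1, fun n c hc hm => (hs.2 n c hc hm).trans hLN⟩

theorem IsLChain.mono {L N : ℕ} (hLN : L ≤ N) {n : ℕ} {c : Fin n → Curtain X}
    (hc : IsLChain L c) : IsLChain N c :=
  ⟨hc.1, fun i j hij => (hc.2 i j hij).mono hLN⟩

theorem dL_le_of_forall {L : ℕ} {x y : X} {r : ℝ} (hr : 0 ≤ r)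
    (h : ∀ (n : ℕ) (c : Fin n → Curtain X), IsLChain L c → (∀ i, (c i).Separates {x} {y}) →
      (n : ℝ) ≤ r) : dL L x y ≤ ENNReal.ofReal (1 + r) := by
  unfold dL
  split_ifs with hxy
  · exact zero_le
  rw [ENNReal.ofReal_add zero_le_one hr, ENNReal.ofReal_one]
  gcongr
  refine iSup_le fun n => iSup_le fun c => iSup_le fun hc => iSup_le fun hs => ?_
  rw [← ENNReal.ofReal_natCast]
  exact ENNReal.ofReal_le_ofReal (h n c hc hs)

theorem le_dL_of_isLChain {L : ℕ} {x y : X} (hxy : x ≠ y) {n : ℕ} {c : Fin n → Curtain X}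
    (hc : IsLChain L c) (hs : ∀ i, (c i).Separates {x} {y}) :
    ENNReal.ofReal (1 + n) ≤ dL L x y := by
  rw [dL, if_neg hxy, ENNReal.ofReal_add zero_le_one (Nat.cast_nonneg n), ENNReal.ofReal_one,
    ENNReal.ofReal_natCast]
  gcongr
  exact le_iSup_of_le n (le_iSup_of_le c (le_iSup_of_le hc (le_iSup_of_le hs le_rfl)))

theorem summable_one_div_succ_sq : Summable fun L : ℕ => 1 / ((L : ℝ) + 1) ^ 2 := by
  have := (summable_nat_add_iff 1).2 (Real.summable_one_div_nat_pow.2 one_lt_two)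
  simpa using this

/-- If `N`-chains separating `x` from `y` have at most `m` members, then the distance of `x` and
`y` in the curtain model is at most of the order of `m + d(x,y) / N`. -/
theorem IsCAT0.dHat_le (hX : IsCAT0 X) {x y : X} {N m : ℕ} (hN : 0 < N)
    (h : ∀ (n : ℕ) (c : Fin n → Curtain X), IsLChain N c → (∀ i, (c i).Separates {x} {y}) →
      n ≤ m) :
    dHat x y ≤ ENNReal.ofReal
      ((1 + m + (1 + dist x y) / N) * ∑' L : ℕ, 1 / ((L : ℝ) + 1) ^ 2) := by
  have hN' : (0 : ℝ) < N := by exact_mod_cast hN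
  have hd : 0 ≤ dist x y := dist_nonneg
  set B : ℝ := 1 + m + (1 + dist x y) / N with hB
  have hB0 : 0 ≤ B := by positivity
  have hterm : ∀ L : ℕ, dL (L + 1) x y / ((L + 1 : ℕ) : ℝ≥0∞) ^ 3 ≤
      ENNReal.ofReal (B * (1 / ((L : ℝ) + 1) ^ 2)) := by
    intro L
    have hL : (1 : ℝ) ≤ (L : ℝ) + 1 := by linarith [(Nat.cast_nonneg L : (0 : ℝ) ≤ L)]
    -- Up to index `N`, chains are `N`-chains and have at most `m` members; beyond it, the trivial
    -- bound `1 + dist x y` is at most `B * N`. A bound linear in the index is summable against the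
    -- cubic weight.
    have h1 : dL (L + 1) x y ≤ ENNReal.ofReal (B * ((L : ℝ) + 1)) := by
      rcases le_or_gt (L + 1) N with hLN | hLN
      · refine (dL_le_of_forall (r := m) (Nat.cast_nonneg m) fun n c hc hs => by
          exact_mod_cast h n c (hc.mono hLN) hs).trans (ENNReal.ofReal_le_ofReal ?_)
        have : 1 + (m : ℝ) ≤ B := by rw [hB]; linarith [(by positivity : 0 ≤ (1 + dist x y) / N)]
        nlinarith
      · refine (dL_le_of_forall hd fun n c hc hs => hc.1.card_le_dist hX hs).trans
          (ENNReal.ofReal_le_ofReal ?_)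
        have h2 : (1 + dist x y) / N ≤ B := by
          rw [hB]; linarith [(Nat.cast_nonneg m : (0 : ℝ) ≤ m)]
        have h3 : (N : ℝ) ≤ (L : ℝ) + 1 := by exact_mod_cast hLN.le
        calc 1 + dist x y = (1 + dist x y) / N * N := by field_simp
          _ ≤ B * ((L : ℝ) + 1) := by gcongr
    have h4 : (((L + 1 : ℕ) : ℝ≥0∞)) ^ 3 = ENNReal.ofReal (((L : ℝ) + 1) ^ 3) := by
      rw [← ENNReal.ofReal_natCast, ← ENNReal.ofReal_pow (Nat.cast_nonneg _)]
      push_cast; rfl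
    have h5 : B * (1 / ((L : ℝ) + 1) ^ 2) = B * ((L : ℝ) + 1) / ((L : ℝ) + 1) ^ 3 := by
      field_simp
    rw [h4, h5, ENNReal.ofReal_div_of_pos (by positivity)]
    gcongr
  calc dHat x y ≤ ∑' L : ℕ, ENNReal.ofReal (B * (1 / ((L : ℝ) + 1) ^ 2)) :=
        ENNReal.tsum_le_tsum hterm
    _ = _ := by
        rw [← ENNReal.ofReal_tsum_of_nonneg (fun L => by positivity)
          (summable_one_div_succ_sq.mul_left B), tsum_mul_left]

end CurtainModel

/-! ### Subadditivity of concave functions -/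

section SublinearFunctions

variable {κ : ℝ → ℝ}

/-- Concavity and `0 ≤ κ 0` make `κ r / r` nonincreasing; comparing `s` and `t` with `s + t` and
adding gives the claim. -/
theorem IsSublinearFunction.add_le (hκ : IsSublinearFunction κ) {s t : ℝ} (hs : 0 ≤ s)
    (ht : 0 ≤ t) : κ (s + t) ≤ κ s + κ t := by
  rcases (add_nonneg hs ht).eq_or_lt with h0 | hpos
  · have h1 : s = 0 := by linarith
    have h2 : t = 0 := by linarith
    subst h1 h2
    have := hκ.one_le 0 le_rfl
    simp only [add_zero]; linarith
  have key : ∀ r, 0 ≤ r → r ≤ s + t → r * κ (s + t) ≤ (s + t) * κ r := by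
    intro r hr hr'
    have h := hκ.concaveOn.2 (mem_Ici.2 le_rfl) (mem_Ici.2 hpos.le)
      (sub_nonneg.2 ((div_le_one hpos).2 hr')) (div_nonneg hr hpos.le) (sub_add_cancel _ _)
    simp only [smul_eq_mul, mul_zero, zero_add, div_mul_cancel₀ r hpos.ne'] at h
    have h0 := hκ.one_le 0 le_rfl
    have h1 : 0 ≤ (1 - r / (s + t)) * κ 0 :=
      mul_nonneg (sub_nonneg.2 ((div_le_one hpos).2 hr')) (by linarith)
    have h2 : r / (s + t) * κ (s + t) ≤ κ r := by linarith
    calc r * κ (s + t) = (s + t) * (r / (s + t) * κ (s + t)) := by field_simp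
      _ ≤ _ := by gcongr
  have h1 := key s hs (by linarith)
  have h2 := key t ht (by linarith)
  refine le_of_mul_le_mul_left ?_ hpos
  linarith

end SublinearFunctions

/-! ### Persistent shadow implies contracting -/

section Rays

variable {X : Type*} [MetricSpace X] {o : X} {b : ℝ → X}

theorem IsGeodesicRay.isClosedGeodesic (hb : IsGeodesicRay o b) : IsClosedGeodesic b (Ici 0) :=
  ⟨isClosed_Ici, ordConnected_Ici, nonempty_Ici, hb.1⟩

theorem IsGeodesicRay.projParam_origin (hX : IsCAT0 X) (hb : IsGeodesicRay o b) :
    projParam b (Ici 0) o = 0 := by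
  have := hX.projParam_self hb.isClosedGeodesic (mem_Ici.2 (le_refl (0 : ℝ)))
  rwa [hb.2] at this

theorem IsGeodesicRay.projParam_le (hX : IsCAT0 X) (hb : IsGeodesicRay o b) (x : X) :
    projParam b (Ici 0) x ≤ dist o x := by
  have := hX.abs_projParam_sub_le hb.isClosedGeodesic x o
  rw [hb.projParam_origin hX, sub_zero, dist_comm] at this
  exact (le_abs_self _).trans this

/-- Persistent shadows bound projections of balls disjoint from the ray. -/
theorem IsGeodesicRay.abs_projParam_sub_le_of_shadow (hX : IsCAT0 X) {κ : ℝ → ℝ}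
    (hκ : IsSublinearFunction κ) (hb : IsGeodesicRay o b) {C : ℝ} (hC : 0 < C)
    (hshadow : ∀ s t : ℝ, 0 ≤ s → s < t →
      ENNReal.ofReal (C * ((t - s) / κ t) - C) ≤ dHat (b s) (b t)) :
    ∃ K : ℝ, 0 ≤ K ∧ ∀ x y : X, dist x y < dist x (b (projParam b (Ici 0) x)) →
      |projParam b (Ici 0) x - projParam b (Ici 0) y| ≤ K * κ (dist o x) ^ 2 := by
  set S : ℝ := ∑' L : ℕ, 1 / ((L : ℝ) + 1) ^ 2
  have hS : 0 ≤ S := tsum_nonneg fun L => by positivity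
  refine ⟨4 / C * (2 * C + S * (20 + 12 * S / C)), by positivity, fun x y hxy => ?_⟩
  have ha := hb.isClosedGeodesic
  set p := projParam b (Ici 0) x with hp
  set q := projParam b (Ici 0) y with hq
  have hp0 : 0 ≤ p := ha.projParam_mem x
  have hq0 : 0 ≤ q := ha.projParam_mem y
  set k := κ (dist o x) with hk
  have hk1 : 1 ≤ k := hκ.one_le _ dist_nonneg
  have hk0 : 0 < k := by linarith
  -- This makes `S / N ≤ C / (4 * k)`, half the slope `C / (2 * k)` guaranteed by the shadow since
  -- `κ t ≤ 2 * k`. The summand 1 keeps `N` positive even without knowing `S > 0`.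
  set N : ℕ := ⌈4 * S * k / C⌉₊ + 1 with hN
  have hNlow : 4 * S * k / C ≤ N := by
    rw [hN]; push_cast; linarith [Nat.le_ceil (4 * S * k / C)]
  have hNup : (N : ℝ) ≤ 4 * S * k / C + 2 := by
    rw [hN]; push_cast; linarith [Nat.ceil_lt_add_one (by positivity : 0 ≤ 4 * S * k / C)]
  have hN0 : (0 : ℝ) < N := by rw [hN]; positivity
  have main : ∀ s t : ℝ, 0 ≤ s → s < t → t ≤ 2 * dist o x →
      (∀ (n : ℕ) (c : Fin n → Curtain X), IsLChain N c →
        (∀ i, (c i).Separates {b s} {b t}) → n ≤ 3 * N + 13) →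
      t - s ≤ 4 / C * (2 * C + S * (20 + 12 * S / C)) * k ^ 2 := by
    intro s t hs hst ht hno
    have h1 := (hshadow s t hs hst).trans (hX.dHat_le (by omega) hno)
    rw [hb.1 s hs t (hs.trans hst.le), abs_sub_comm, abs_of_pos (sub_pos.2 hst)] at h1
    rw [ENNReal.ofReal_le_ofReal_iff (by have := sub_pos.2 hst; positivity)] at h1
    have hκt : κ t ≤ 2 * k := by
      have h2 := hκ.monotoneOn (mem_Ici.2 (hs.trans hst.le))
        (mem_Ici.2 ((hs.trans hst.le).trans ht)) ht
      rw [two_mul] at h2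
      have := hκ.add_le (dist_nonneg : 0 ≤ dist o x) (dist_nonneg : 0 ≤ dist o x)
      linarith
    have hκt0 : 0 < κ t := by linarith [hκ.one_le t (hs.trans hst.le)]
    set T := t - s with hT
    have hT0 : 0 < T := sub_pos.2 hst
    have h3 : C * (T / (2 * k)) ≤ C * (T / κ t) := by gcongr
    have h4 : S / N ≤ C / (4 * k) := by
      rw [div_le_div_iff₀ hN0 (by positivity)]
      rw [div_le_iff₀ hC] at hNlow
      linarith
    have h5 : (1 + T) / N * S ≤ (1 + T) * (C / (4 * k)) := by
      rw [div_mul_eq_mul_div, mul_div_assoc]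
      gcongr
    have h6 : C / (4 * k) ≤ C := by
      rw [div_le_iff₀ (by positivity)]; nlinarith
    have h7 : (1 + ((3 * N + 13 : ℕ) : ℝ)) ≤ (20 + 12 * S / C) * k := by
      push_cast
      have : 12 * S / C * k = 3 * (4 * S * k / C) := by ring
      nlinarith
    have h8 := mul_le_mul_of_nonneg_right h7 hS
    have h9 : C * (T / (2 * k)) = T * (C / (4 * k)) + T * (C / (4 * k)) := by
      field_simp; ring
    have h10 : T * (C / (4 * k)) ≤ 2 * C + S * (20 + 12 * S / C) * k := by
      have : (1 + ((3 * N + 13 : ℕ) : ℝ) + (1 + T) / N) * S =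
        (1 + ((3 * N + 13 : ℕ) : ℝ)) * S + (1 + T) / N * S := by ring
      linarith
    have h11 : 2 * C + S * (20 + 12 * S / C) * k ≤ (2 * C + S * (20 + 12 * S / C)) * k := by
      nlinarith
    calc T = 4 / C * k * (T * (C / (4 * k))) := by field_simp
      _ ≤ 4 / C * k * ((2 * C + S * (20 + 12 * S / C)) * k) :=
        mul_le_mul_of_nonneg_left (h10.trans h11) (by positivity)
      _ = _ := by ring
  have hpo : p ≤ dist o x := hb.projParam_le hX x
  have hqo : q ≤ 2 * dist o x := by
    have h1 := hb.projParam_le hX y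
    have h2 := dist_triangle o x y
    have h3 := ha.dist_proj_le x (mem_Ici.2 (le_refl (0 : ℝ)))
    rw [hb.2, dist_comm x o] at h3
    linarith
  have hd : 0 ≤ dist o x := dist_nonneg
  rcases lt_trichotomy p q with hlt | heq | hlt
  · rw [abs_sub_comm, abs_of_pos (sub_pos.2 hlt)]
    refine main p q hp0 hlt hqo fun n c hc hs => ?_
    have := hc.card_lt_of_dist_lt hX ha hs hxy
    omega
  · rw [heq, sub_self, abs_zero]; positivity
  · rw [abs_of_pos (sub_pos.2 hlt)]
    refine main q p hq0 hlt (by linarith) fun n c hc hs => ?_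
    have := hc.card_lt_of_dist_lt hX ha (fun i => (hs i).symm) hxy
    omega

/-- A ray with a persistent shadow is contracting. -/
theorem HasPersistentShadow.isContractingRay (hX : IsCAT0 X) {κ : ℝ → ℝ}
    (hκ : IsSublinearFunction κ) (hb : IsGeodesicRay o b) (h : HasPersistentShadow κ b) :
    IsContractingRay (fun t => κ t ^ 2) o b := by
  obtain ⟨C, hC, hshadow⟩ := h
  obtain ⟨K, hK, hproj⟩ := hb.abs_projParam_sub_le_of_shadow hX hκ hC hshadow
  have ha := hb.isClosedGeodesic
  -- Two feet each within `K * κ ^ 2` of the foot of the centre; the extra 1 makes the inequality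
  -- strict.
  refine ⟨2 * K + 1, by positivity, fun x ρ hρ hdisj => ?_⟩
  have hk : 1 ≤ κ (dist o x) := hκ.one_le _ dist_nonneg
  have hball : ∀ y ∈ Metric.ball x ρ,
      |projParam b (Ici 0) x - projParam b (Ici 0) y| ≤ K * κ (dist o x) ^ 2 := by
    intro y hy
    refine hproj x y ((Metric.mem_ball'.1 hy).trans_le ?_)
    by_contra! hlt
    exact Set.disjoint_left.1 hdisj (Metric.mem_ball'.2 hlt)
      (mem_image_of_mem b (ha.projParam_mem x))
  have hle : Metric.ediam (projImage (b '' Ici 0) (Metric.ball x ρ)) ≤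
      ENNReal.ofReal (2 * K * κ (dist o x) ^ 2) := by
    refine Metric.ediam_le ?_
    rintro _ ⟨y, hy, ⟨⟨s, hs, rfl⟩, hys⟩⟩ _ ⟨z, hz, ⟨⟨t, ht, rfl⟩, hzt⟩⟩
    have e1 := hX.projParam_eq ha hs ⟨mem_image_of_mem b hs, hys⟩
    have e2 := hX.projParam_eq ha ht ⟨mem_image_of_mem b ht, hzt⟩
    have h1 := hball y hy
    have h2 := hball z hz
    rw [e1, abs_le] at h1
    rw [e2, abs_le] at h2
    rw [edist_dist, hb.1 s hs t ht]
    refine ENNReal.ofReal_le_ofReal (abs_le.2 ⟨?_, ?_⟩) <;> linarith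
  refine hle.trans_lt ((ENNReal.ofReal_lt_ofReal_iff (by positivity)).2 ?_)
  nlinarith

end Rays

/-! ### Curtains crossing a contracting stretch -/

section Crossing

variable {X : Type*} [MetricSpace X] {a : ℝ → X} {I : Set ℝ}

/-- Balls of radius `R` around the points at distance `R` from the geodesic `a` whose projection
has its parameter in `W` project to sets of radius at most `D`. -/
def IsContractingAtScale (a : ℝ → X) (I : Set ℝ) (R D : ℝ) (W : Set ℝ) : Prop :=
  ∀ z, projParam a I z ∈ W → dist z (a (projParam a I z)) = R →
    ∀ z', dist z z' < R → |projParam a I z' - projParam a I z| ≤ D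

theorem IsContractingAtScale.mono {R D : ℝ} {V W : Set ℝ} (h : IsContractingAtScale a I R D W)
    (hVW : V ⊆ W) : IsContractingAtScale a I R D V := fun z hz => h z (hVW hz)

/-- Points at height `R` with distant projections are nearly as far apart as in a tree. -/
theorem IsContractingAtScale.le_dist (hX : IsCAT0 X) (ha : IsClosedGeodesic a I) {R D : ℝ}
    {W : Set ℝ} (hR : 0 < R) (hD : 20 * D ≤ R) (h : IsContractingAtScale a I R D W) {x y : X}
    (hx : projParam a I x ∈ W) (hy : projParam a I y ∈ W)
    (hxR : dist x (a (projParam a I x)) = R) (hyR : dist y (a (projParam a I y)) = R)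
    (hxy : R ≤ |projParam a I x - projParam a I y|) :
    |projParam a I x - projParam a I y| + 37 / 20 * R ≤ dist x y := by
  obtain ⟨β, hβ⟩ := hX.exists_segment x y
  have key : ∀ s ∈ Icc 0 (dist x y), ∀ t ∈ Icc 0 (dist x y), s < R → dist x y - t < R →
      |projParam a I x - projParam a I y| ≤ |s - t| + 2 * D := by
    intro s hs t ht hsR htR
    have h1 := h x hx hxR (β s) (by rwa [hβ.dist_left hs])
    have h2 := h y hy hyR (β t) (by rwa [dist_comm, hβ.dist_right ht])
    have h3 := hX.abs_projParam_sub_le ha (β s) (β t)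
    rw [hβ.1 s hs t ht] at h3
    rw [abs_le] at h1 h2 h3 ⊢
    constructor <;> linarith
  by_cases hlt : dist x y / 2 < R
  · have hm : dist x y / 2 ∈ Icc 0 (dist x y) := by
      have : 0 ≤ dist x y := dist_nonneg
      constructor <;> linarith
    have := key _ hm _ hm hlt (by linarith)
    rw [sub_self, abs_zero] at this
    linarith
  -- Just under `R` is cut from each end, and the projection moves at most `2 * D ≤ R / 10` in these
  -- pieces: `39 / 20 - 1 / 10 = 37 / 20`.
  · have := key (39 / 40 * R) ⟨by linarith, by linarith⟩ (dist x y - 39 / 40 * R)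
      ⟨by linarith, by linarith⟩ (by linarith) (by linarith)
    rw [abs_sub_comm (39 / 40 * R),
      abs_of_nonneg (by linarith : 0 ≤ dist x y - 39 / 40 * R - 39 / 40 * R)] at this
    linarith

theorem IsSegment.symm_mem {γ : ℝ → X} {x y : X} (h : IsSegment γ x y) {s : ℝ}
    (hs : s ∈ Icc 0 (dist x y)) : dist y (γ s) + dist (γ s) x = dist y x := by
  rw [dist_comm y, h.dist_right hs, dist_comm (γ s), h.dist_left hs, dist_comm y]; ring

/-- The point of a geodesic closest to `a` has height at most `R` if the geodesic has a point
whose projection is at distance between `R` and `2R` from the projection of that point. -/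
theorem IsContractingAtScale.height_le (hX : IsCAT0 X) (ha : IsClosedGeodesic a I) {R D : ℝ}
    {W : Set ℝ} (hR : 0 < R) (hD : 20 * D ≤ R) (h : IsContractingAtScale a I R D W)
    {γ : ℝ → X} {J : Set ℝ} (hγ : IsClosedGeodesic γ J) {s t : ℝ} (hs : s ∈ J) (ht : t ∈ J)
    (hsW : projParam a I (γ s) ∈ W) (htW : projParam a I (γ t) ∈ W)
    (hmin : ∀ u ∈ J, dist (γ s) (a (projParam a I (γ s))) ≤ dist (γ u) (a (projParam a I (γ u))))
    (h₁ : R ≤ |projParam a I (γ s) - projParam a I (γ t)|)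
    (h₂ : |projParam a I (γ s) - projParam a I (γ t)| ≤ 2 * R) :
    dist (γ s) (a (projParam a I (γ s))) ≤ R := by
  by_contra! hlt
  set p := projParam a I (γ s) with hp
  set q := projParam a I (γ t) with hq
  have hpI : p ∈ I := ha.projParam_mem _
  have hqI : q ∈ I := ha.projParam_mem _
  obtain ⟨e, he⟩ := hX.exists_segment (a p) (γ s)
  obtain ⟨f, hf⟩ := hX.exists_segment (a q) (γ t)
  have hts := hmin t ht
  set m := |p - q| with hm
  set r := dist (a p) (γ s) with hr
  set w := dist (a q) (γ t) with hw
  rw [dist_comm (γ s) (a p)] at hlt hts hmin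
  rw [dist_comm (γ t) (a q)] at hts
  have hRr : R < r := hlt
  have hRw : R < w := hRr.trans_le hts
  have hRr' : R ∈ Icc 0 r := ⟨hR.le, hRr.le⟩
  have hRw' : R ∈ Icc 0 w := ⟨hR.le, hRw.le⟩
  set x := e R with hx
  set y := f R with hy
  have hxp : projParam a I x = p :=
    hX.projParam_eq_of_dist_add ha (he.symm_mem hRr')
  have hyq : projParam a I y = q :=
    hX.projParam_eq_of_dist_add ha (hf.symm_mem hRw')
  have hxR : dist x (a p) = R := by rw [dist_comm]; exact he.dist_left hRr'
  have hyR : dist y (a q) = R := by rw [dist_comm]; exact hf.dist_left hRw'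
  have hA : m + 37 / 20 * R ≤ dist x y := by
    have := h.le_dist hX ha hR hD (x := x) (y := y) (by rwa [hxp]) (by rwa [hyq])
      (by rw [hxp, hxR]) (by rw [hyq, hyR]) (by rwa [hxp, hyq])
    rwa [hxp, hyq] at this
  have hpq : dist (a p) (a q) = m := ha.isGeodesicOn p hpI q hqI
  have hB : dist (a q) x ≤ R + m := by
    have := dist_triangle x (a p) (a q)
    rw [dist_comm (a q)]; linarith
  -- Here `m ≤ 2 * R` is needed. The excess over `(m + R) ^ 2` is what Stewart along `f` turns into
  -- `m + w ≤ dist (γ t) x`.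
  have hA2 : (m + R) ^ 2 + R * (2 * m + R) ≤ dist x y ^ 2 := by
    have : (m + 37 / 20 * R) ^ 2 ≤ dist x y ^ 2 := by gcongr
    nlinarith [mul_nonneg hR.le (sub_nonneg.2 h₂)]
  have hB2 : dist (a q) x ^ 2 ≤ (R + m) ^ 2 := by gcongr
  have hw0 : 0 < w := hR.trans hRw
  have hr0 : 0 < r := hR.trans hRr
  have hst := hX.stewart hf x (τ := R / w) ⟨by positivity, (div_le_one hw0).2 hRw.le⟩
  rw [show R / w * dist (a q) (γ t) = R from div_mul_cancel₀ R hw0.ne', dist_comm (f R) x] at hst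
  have hst2 : w * dist x y ^ 2 ≤
      (w - R) * dist (a q) x ^ 2 + R * dist (γ t) x ^ 2 - R * (w - R) * w := by
    calc w * dist x y ^ 2 ≤ w * ((1 - R / w) * dist (a q) x ^ 2 + R / w * dist (γ t) x ^ 2 -
          R / w * (1 - R / w) * w ^ 2) := mul_le_mul_of_nonneg_left hst hw0.le
      _ = _ := by field_simp
  have hc2 : (m + w) ^ 2 ≤ dist (γ t) x ^ 2 := by
    refine le_of_mul_le_mul_left ?_ hR
    nlinarith [mul_le_mul_of_nonneg_left hA2 hw0.le,
      mul_le_mul_of_nonneg_left hB2 (sub_nonneg.2 hRw.le),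
      mul_nonneg (mul_nonneg hR.le hR.le) (add_nonneg (abs_nonneg (p - q)) hR.le),
      mul_nonneg (mul_nonneg hR.le hR.le) (abs_nonneg (p - q)), mul_pos (mul_pos hR hR) hR]
  have hc : m + w ≤ dist (γ t) x := by
    exact abs_le_of_sq_le_sq' hc2 dist_nonneg |>.2
  have hpt : dist (a p) (γ t) ≤ dist (γ t) x := by
    have := dist_triangle (a p) (a q) (γ t)
    linarith
  have hconv := hX.dist_geodesic_le he.1 ordConnected_Icc (s := 0) (t := r)
    ⟨le_rfl, hr0.le⟩ ⟨hr0.le, le_rfl⟩ (γ t) (τ := R / r)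
    ⟨by positivity, (div_le_one hr0).2 hRr.le⟩
  rw [mul_zero, zero_add, div_mul_cancel₀ R hr0.ne', he.2.1, show e r = γ s from he.2.2,
    dist_comm (e R)] at hconv
  have hτ : 0 < R / r := by positivity
  have hτ1 : 0 ≤ 1 - R / r := sub_nonneg.2 ((div_le_one hr0).2 hRr.le)
  have hcs : dist (γ t) x ≤ dist (γ s) (γ t) := by
    refine le_of_mul_le_mul_left ?_ hτ
    have := mul_le_mul_of_nonneg_left hpt hτ1
    change dist (γ t) x ≤ _ at hconv
    linarith
  have hxs : dist x (γ s) = r - R := he.dist_right hRr'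
  -- Minimality of the height puts every point of `γ` at distance at least `r - R` from `x`.
  -- Pythagoras then gives `dist (γ s) (γ t) < dist (γ t) x`, against `hcs`.
  have hclosest : IsClosest (γ '' J) x (γ s) := by
    refine ⟨mem_image_of_mem γ hs, ?_⟩
    rintro _ ⟨u, hu, rfl⟩
    have h3 := hmin u hu
    have h4 := ha.dist_proj_le (γ u) hpI
    have h5 := dist_triangle_left (γ u) (a p) x
    linarith
  have hpyth := hX.pythagoras_of_isClosest hγ hs hclosest ht
  have hd : dist (γ s) (γ t) ^ 2 = (t - s) ^ 2 := by
    rw [hγ.isGeodesicOn s hs t ht, sq_abs]; ring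
  have hcs2 : dist (γ t) x ^ 2 ≤ dist (γ s) (γ t) ^ 2 := by gcongr
  rw [dist_comm x (γ t), hxs] at hpyth
  nlinarith [sq_nonneg (r - R), mul_pos (sub_pos.2 hRr) (sub_pos.2 hRr)]

/-- A segment whose projection crosses a stretch of length `2R` comes `R`-close to it. -/
theorem IsContractingAtScale.exists_near (hX : IsCAT0 X) (ha : IsClosedGeodesic a I) {R D v : ℝ}
    (hR : 0 < R) (hD : 20 * D ≤ R) (h : IsContractingAtScale a I R D (Icc v (v + 2 * R)))
    {γ : ℝ → X} {x y : X} (hγ : IsSegment γ x y) (hx : projParam a I x ≤ v)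
    (hy : v + 2 * R ≤ projParam a I y) :
    ∃ s ∈ Icc 0 (dist x y), projParam a I (γ s) ∈ Icc v (v + 2 * R) ∧
      dist (γ s) (a (projParam a I (γ s))) ≤ R := by
  set ℓ := dist x y
  have hℓ : 0 ≤ ℓ := dist_nonneg
  set f : ℝ → ℝ := fun s => projParam a I (γ s) with hf
  have hfc : ContinuousOn f (Icc 0 ℓ) :=
    (hX.lipschitzWith_projParam ha).continuous.comp_continuousOn hγ.continuousOn
  have hf0 : f 0 ≤ v := by rw [hf]; simpa only [hγ.2.1] using hx
  have hfℓ : v + 2 * R ≤ f ℓ := by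
    change v + 2 * R ≤ projParam a I (γ (dist x y))
    rwa [hγ.2.2]
  -- The segment is trimmed from the last visit to `v` before the first visit to `v + 2 * R`, so its
  -- projection stays in the window. The foot of the lowest point is then at distance between `R`
  -- and `2 * R` from the foot of one end.
  obtain ⟨s₂, ⟨hs₂, hs₂v⟩, hleast⟩ :=
    ((hfc.preimage_isClosed_of_isClosed isClosed_Icc (isClosed_Ici (a := v + 2 * R))
      |> isCompact_Icc.of_isClosed_subset) inter_subset_left).exists_isLeast
      ⟨ℓ, ⟨hℓ, le_rfl⟩, hfℓ⟩
  have hsub₂ : Icc 0 s₂ ⊆ Icc 0 ℓ := Icc_subset_Icc_right hs₂.2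
  obtain ⟨s₁, ⟨hs₁, hs₁v⟩, hgreatest⟩ :=
    (((hfc.mono hsub₂).preimage_isClosed_of_isClosed isClosed_Icc (isClosed_Iic (a := v))
      |> isCompact_Icc.of_isClosed_subset) inter_subset_left).exists_isGreatest
      ⟨0, ⟨le_rfl, hs₂.1⟩, hf0⟩
  simp only [mem_preimage, mem_Ici, mem_Iic] at hs₂v hs₁v
  have hJ : Icc s₁ s₂ ⊆ Icc 0 ℓ := (Icc_subset_Icc_left hs₁.1).trans hsub₂
  have hfs₂ : f s₂ = v + 2 * R := by
    obtain ⟨s, hs, hsv⟩ := intermediate_value_Icc hs₂.1 (hfc.mono hsub₂)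
      (⟨by linarith, hs₂v⟩ : v + 2 * R ∈ Icc (f 0) (f s₂))
    have : s₂ ≤ s := hleast ⟨hsub₂ hs, hsv.ge⟩
    rw [le_antisymm this hs.2, hsv]
  have hfs₁ : f s₁ = v := by
    obtain ⟨s, hs, hsv⟩ := intermediate_value_Icc hs₁.2 (hfc.mono hJ)
      (⟨hs₁v, by linarith⟩ : v ∈ Icc (f s₁) (f s₂))
    have : s ≤ s₁ := hgreatest ⟨⟨hs₁.1.trans hs.1, hs.2⟩, hsv.le⟩
    rw [le_antisymm hs.1 this, hsv]
  have hwin : ∀ s ∈ Icc s₁ s₂, f s ∈ Icc v (v + 2 * R) := by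
    intro s hs
    constructor
    · by_contra! hlt
      have : s ≤ s₁ := hgreatest ⟨⟨hs₁.1.trans hs.1, hs.2⟩, hlt.le⟩
      rw [le_antisymm this hs.1, hfs₁] at hlt
      exact lt_irrefl _ hlt
    · by_contra! hlt
      have : s₂ ≤ s := hleast ⟨hJ hs, hlt.le⟩
      rw [le_antisymm hs.2 this, hfs₂] at hlt
      exact lt_irrefl _ hlt
  have hgc : ContinuousOn (fun s => dist (γ s) (a (f s))) (Icc s₁ s₂) :=
    continuous_dist.comp_continuousOn ((hγ.continuousOn.mono hJ).prodMk
      (ha.isGeodesicOn.continuousOn.comp (hfc.mono hJ) fun s _ => ha.projParam_mem _))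
  obtain ⟨s₀, hs₀, hmin⟩ := isCompact_Icc.exists_isMinOn ⟨s₁, le_rfl, hs₁.2⟩ hgc
  have hγJ : IsClosedGeodesic γ (Icc s₁ s₂) :=
    ⟨isClosed_Icc, ordConnected_Icc, ⟨s₁, le_rfl, hs₁.2⟩,
      fun s hs t ht => hγ.1 s (hJ hs) t (hJ ht)⟩
  refine ⟨s₀, hJ hs₀, hwin s₀ hs₀, ?_⟩
  have h0 : v ≤ projParam a I (γ s₀) ∧ projParam a I (γ s₀) ≤ v + 2 * R := hwin s₀ hs₀
  change projParam a I (γ s₂) = v + 2 * R at hfs₂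
  change projParam a I (γ s₁) = v at hfs₁
  rcases le_total (f s₀) (v + R) with hle | hle
  · have ht : s₂ ∈ Icc s₁ s₂ := ⟨hs₁.2, le_rfl⟩
    change projParam a I (γ s₀) ≤ v + R at hle
    refine h.height_le hX ha hR hD hγJ hs₀ ht (hwin _ hs₀) (hwin _ ht)
      (fun u hu => hmin hu) ?_ ?_ <;>
    · rw [hfs₂, abs_sub_comm, abs_of_nonneg (by linarith)]; linarith
  · have ht : s₁ ∈ Icc s₁ s₂ := ⟨le_rfl, hs₁.2⟩
    change v + R ≤ projParam a I (γ s₀) at hle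
    refine h.height_le hX ha hR hD hγJ hs₀ ht (hwin _ hs₀) (hwin _ ht)
      (fun u hu => hmin hu) ?_ ?_ <;>
    · rw [hfs₁, abs_of_nonneg (by linarith)]; linarith

/-- A curtain crossing a stretch of length `4R + 1` of the geodesic `a` comes `R`-close to it. -/
theorem IsContractingAtScale.exists_mem_carrier_near (hX : IsCAT0 X) (ha : IsClosedGeodesic a I)
    {R D v : ℝ} (hR : 0 < R) (hD : 20 * D ≤ R)
    (h : IsContractingAtScale a I R D (Icc v (v + 4 * R + 1))) (l : Curtain X) {x y : X}
    (hx : x ∈ l.carrier) (hy : y ∈ l.carrier) (hxv : projParam a I x ≤ v)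
    (hyv : v + 4 * R + 1 ≤ projParam a I y) :
    ∃ z ∈ l.carrier, projParam a I z ∈ Icc v (v + 4 * R + 1) ∧
      dist z (a (projParam a I z)) ≤ R := by
  have hl := l.isClosedGeodesic
  set P := l.path (projParam l.path l.I x) with hP
  set Q := l.path (projParam l.path l.I y) with hQ
  have hx' := (Curtain.mem_carrier_iff hX).1 hx
  have hy' := (Curtain.mem_carrier_iff hX).1 hy
  have hmem : ∀ w ∈ l.carrier, ∀ z, projParam l.path l.I z = projParam l.path l.I w →
      z ∈ l.carrier := by
    intro w hw z hz
    rw [Curtain.mem_carrier_iff hX, Curtain.coord] at hw ⊢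
    rwa [hz]
  have hPQ : dist P Q ≤ 1 := by
    rw [hP, hQ, hl.isGeodesicOn _ (hl.projParam_mem x) _ (hl.projParam_mem y)]
    rw [Curtain.coord, abs_le] at hx' hy'
    rw [abs_le]
    constructor <;> linarith
  have hlip := hX.abs_projParam_sub_le ha P Q
  -- The segments from `x` to `P` and from `Q` to `y` lie in fibres, hence in the curtain, and the
  -- jump from `P` to `Q` costs at most 1. One of them therefore crosses a stretch of length `2 *
  -- R`.
  rcases le_total (v + 2 * R) (projParam a I P) with hle | hle
  · obtain ⟨γ, hγ⟩ := hX.exists_segment x P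
    obtain ⟨s, hs, hsW, hsR⟩ := (h.mono (Icc_subset_Icc_right (by linarith))).exists_near hX ha hR
      hD hγ hxv hle
    exact ⟨γ s, hmem x hx _ (hX.projParam_of_mem_segment hl hγ (mem_image_of_mem γ hs)),
      ⟨hsW.1, by linarith [hsW.2]⟩, hsR⟩
  · obtain ⟨γ, hγ⟩ := hX.exists_segment Q y
    obtain ⟨s, hs, hsW, hsR⟩ := (h.mono (Icc_subset_Icc (by linarith) (by linarith))).exists_near
      hX ha (v := v + 2 * R + 1) hR hD hγ (by linarith [(abs_le.1 hlip).1]) (by linarith)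
    exact ⟨γ s, hmem y hy _ (hX.projParam_eq_of_dist_add hl (hγ.symm_mem hs)),
      ⟨by linarith [hsW.1], by linarith [hsW.2]⟩, hsR⟩

/-- Curtains dual to a contracting geodesic are well separated. -/
theorem IsContractingAtScale.isLSeparated (hX : IsCAT0 X) (ha : IsClosedGeodesic a I)
    {R D r s : ℝ} (hR : 0 < R) (hD : 20 * D ≤ R) (hrs : r + 4 * R + 2 ≤ s)
    (h : IsContractingAtScale a I R D (Icc r s)) {k l : Curtain X}
    (hk : ∀ x, k.coord x = projParam a I x - r) (hl : ∀ x, l.coord x = projParam a I x - s)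
    (hdisj : Disjoint k.carrier l.carrier) {L : ℕ} (hL : 6 * R + 3 ≤ L) : IsLSeparated L k l := by
  refine ⟨hdisj, fun n c hc hm => ?_⟩
  have hL' : (3 : ℝ) ≤ L := by linarith
  have hL'' : 3 ≤ L := by exact_mod_cast hL'
  rcases le_or_gt n 1 with hn | hn
  · omega
  have hz : ∀ i, ∃ z ∈ (c i).carrier,
      projParam a I z ∈ Icc (r + 1 / 2) (r + 1 / 2 + 4 * R + 1) ∧
      dist z (a (projParam a I z)) ≤ R := by
    intro i
    obtain ⟨⟨x, hxc, hxk⟩, ⟨y, hyc, hyl⟩⟩ := hm i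
    rw [Curtain.mem_carrier_iff hX, hk, abs_le] at hxk
    rw [Curtain.mem_carrier_iff hX, hl, abs_le] at hyl
    exact (h.mono (Icc_subset_Icc (by linarith) (by linarith))).exists_mem_carrier_near hX ha hR hD
      (c i) hxc hyc (by linarith) (by linarith)
  choose z hzc hzW hzR using hz
  -- The first and last members give points at distance at least `n - 2` and at most `R + (4 * R +
  -- 1) + R`, whence the bound `6 * R + 3`.
  have h1 := hc.le_dist hX (i := ⟨0, by omega⟩) (j := ⟨n - 1, by omega⟩) (m := n - 2)
    (by simp; omega) (hzc _) (hzc _)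
  set i : Fin n := ⟨0, by omega⟩
  set j : Fin n := ⟨n - 1, by omega⟩
  have h2 := dist_triangle4 (z i) (a (projParam a I (z i))) (a (projParam a I (z j))) (z j)
  rw [ha.isGeodesicOn _ (ha.projParam_mem _) _ (ha.projParam_mem _),
    dist_comm (a (projParam a I (z j))) (z j)] at h2
  have h3 : |projParam a I (z i) - projParam a I (z j)| ≤ 4 * R + 1 := by
    rw [abs_le]
    constructor <;> linarith [(hzW i).1, (hzW i).2, (hzW j).1, (hzW j).2]
  have h4 : (n : ℝ) = ((n - 2 : ℕ) : ℝ) + 2 := by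
    exact_mod_cast (by omega : n = n - 2 + 2)
  have h5 : (n : ℝ) ≤ L := by linarith [hzR i, hzR j]
  exact_mod_cast h5

end Crossing

/-! ### Contracting implies persistent shadow -/

section Shadow

variable {X : Type*} [MetricSpace X] {o : X} {b : ℝ → X} {κ : ℝ → ℝ}

theorem IsSublinearFunction.exists_le_mul_add (hκ : IsSublinearFunction κ) {ε : ℝ} (hε : 0 < ε) :
    ∃ B : ℝ, 0 ≤ B ∧ ∀ t, 0 ≤ t → κ t ≤ ε * t + B := by
  have h := (hκ.growsSublinearly.eventually (gt_mem_nhds hε)).and (eventually_gt_atTop 0)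
  obtain ⟨T, hT⟩ := eventually_atTop.1 h
  have hB := hκ.one_le (max T 0) (le_max_right _ _)
  refine ⟨κ (max T 0), by linarith, fun t ht => ?_⟩
  rcases le_total T t with hle | hle
  · obtain ⟨h1, h2⟩ := hT t hle
    rw [div_lt_iff₀ h2] at h1
    linarith
  · have h1 := hκ.monotoneOn (mem_Ici.2 ht) (mem_Ici.2 (le_max_right T 0))
      (hle.trans (le_max_left _ _))
    have h2 : 0 ≤ ε * t := by positivity
    linarith

/-- A `κ`-contracting ray is contracting at scales comparable to `κ(t)` up to time `t`. -/
theorem IsContractingRay.exists_isContractingAtScale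
    (hκ : IsSublinearFunction κ) (hb : IsGeodesicRay o b) (h : IsContractingRay κ o b) :
    ∃ K : ℝ, 0 < K ∧ ∀ t, 0 ≤ t →
      IsContractingAtScale b (Ici 0) (K * κ t) (K * κ t / 20) (Icc 0 t) := by
  obtain ⟨C, hC, hcontr⟩ := h
  obtain ⟨B, hB, hκB⟩ := hκ.exists_le_mul_add (ε := 1 / (40 * (C + 1))) (by positivity)
  -- The contraction bound involves `κ (dist o z) ≤ κ t + κ R`, with `R` itself depending on `K`.
  -- Sublinearity gives `C * κ R ≤ R / 40 + C * B`, and `K` is large enough that `C * (κ t + B) ≤ R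
  -- / 40`.
  refine ⟨40 * C * (1 + B) + 1, by positivity, fun t ht z hz hzR z' hz' => ?_⟩
  set K := 40 * C * (1 + B) + 1 with hK
  have hK0 : 0 < K := by positivity
  have hk1 : 1 ≤ κ t := hκ.one_le t ht
  have ha := hb.isClosedGeodesic
  set R := K * κ t with hR
  have hR0 : 0 < R := by positivity
  have hdisj : Disjoint (Metric.ball z R) (b '' Ici 0) := by
    rw [Set.disjoint_left]
    rintro _ hmem ⟨u, hu, rfl⟩
    have := ha.dist_proj_le z hu
    rw [Metric.mem_ball'] at hmem
    linarith
  have hmem : ∀ y ∈ Metric.ball z R,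
      b (projParam b (Ici 0) y) ∈ projImage (b '' Ici 0) (Metric.ball z R) :=
    fun y hy => ⟨y, hy, (ha.projParam_spec y).2⟩
  have hlt := (Metric.edist_le_ediam_of_mem (hmem z' (Metric.mem_ball'.2 hz'))
    (hmem z (Metric.mem_ball_self hR0))).trans_lt (hcontr z R hR0 hdisj)
  rw [edist_dist, hb.1 _ (ha.projParam_mem z') _ (ha.projParam_mem z)] at hlt
  refine (ENNReal.ofReal_lt_ofReal_iff'.1 hlt).1.le.trans ?_
  have hoz : dist o z ≤ t + R := by
    have h1 := dist_triangle o (b (projParam b (Ici 0) z)) z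
    have h2 := hb.1 0 (mem_Ici.2 le_rfl) _ (ha.projParam_mem z)
    rw [hb.2, zero_sub, abs_neg, abs_of_nonneg (ha.projParam_mem z)] at h2
    rw [dist_comm (b _) z] at h1
    linarith [hz.2]
  have h1 : κ (dist o z) ≤ κ t + κ R :=
    (hκ.monotoneOn (mem_Ici.2 dist_nonneg) (mem_Ici.2 (by positivity)) hoz).trans
      (hκ.add_le ht hR0.le)
  have h2 := hκB R hR0.le
  have h3 : C * (1 / (40 * (C + 1)) * R) ≤ R / 40 := by
    have : C * (1 / (40 * (C + 1)) * R) = C / (C + 1) * (R / 40) := by field_simp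
    rw [this]
    refine mul_le_of_le_one_left (by positivity) ?_
    rw [div_le_one (by positivity)]; linarith
  have h4 : C * (κ t + B) ≤ R / 40 := by
    have : κ t + B ≤ (1 + B) * κ t := by nlinarith
    have := mul_le_mul_of_nonneg_left this hC
    have : R / 40 = C * ((1 + B) * κ t) + κ t / 40 := by rw [hR, hK]; ring
    linarith
  calc C * κ (dist o z) ≤ C * (κ t + (1 / (40 * (C + 1)) * R + B)) := by
        gcongr; linarith
    _ = C * (κ t + B) + C * (1 / (40 * (C + 1)) * R) := by ring
    _ ≤ R / 20 := by linarith

theorem le_dHat_of_isLChain {L : ℕ} (hL : 0 < L) {x y : X} (hxy : x ≠ y) {n : ℕ}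
    {c : Fin n → Curtain X} (hc : IsLChain L c) (hs : ∀ i, (c i).Separates {x} {y}) :
    ENNReal.ofReal ((1 + n) / (L : ℝ) ^ 3) ≤ dHat x y := by
  obtain ⟨L, rfl⟩ := Nat.exists_eq_add_one.2 hL
  -- A single term of the series is kept.
  refine le_trans ?_ (ENNReal.le_tsum L)
  rw [ENNReal.ofReal_div_of_pos (by positivity), ENNReal.ofReal_pow (Nat.cast_nonneg _),
    ENNReal.ofReal_natCast]
  gcongr
  exact le_dL_of_isLChain hxy hc hs

/-- A `κ`-contracting ray has a `κ⁴`-persistent shadow. -/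
theorem IsContractingRay.hasPersistentShadow (hX : IsCAT0 X)
    (hκ : IsSublinearFunction κ) (hb : IsGeodesicRay o b) (h : IsContractingRay κ o b) :
    HasPersistentShadow (fun t => κ t ^ 4) b := by
  obtain ⟨K, hK, hscale⟩ := h.exists_isContractingAtScale hκ hb
  have ha := hb.isClosedGeodesic
  refine ⟨1 / ((4 * K + 2) * (6 * K + 4) ^ 3), by positivity, fun s t hs hst => ?_⟩
  have ht : 0 ≤ t := hs.trans hst.le
  have hk1 : 1 ≤ κ t := hκ.one_le t ht
  set R := K * κ t with hR
  have hR0 : 0 < R := by positivity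
  set M := 4 * R + 2 with hM
  set n := ⌊(t - s) / M⌋₊ with hn
  set L := ⌈6 * R + 3⌉₊ with hL
  have hnle : M * n ≤ t - s := by
    have := Nat.floor_le (div_nonneg (sub_nonneg.2 hst.le) (by positivity : 0 ≤ M))
    rw [le_div_iff₀ (by positivity)] at this
    linarith
  have hnge : (t - s) / M ≤ 1 + n := by
    have := Nat.lt_floor_add_one ((t - s) / M)
    linarith
  have hLge : 6 * R + 3 ≤ L := Nat.le_ceil _
  have hLle : (L : ℝ) ≤ (6 * K + 4) * κ t := by
    have := Nat.ceil_lt_add_one (by positivity : 0 ≤ 6 * R + 3)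
    nlinarith
  have hL0 : 0 < L := by
    have : (0 : ℝ) < L := by linarith
    exact_mod_cast this
  obtain ⟨c, hc, hcoord⟩ := hX.exists_dual_curtains ha (u := s) (M := M) (by linarith) (n := n)
    fun u hu => mem_Ici.2 (hs.trans hu.1.le)
  have hpos : ∀ i : Fin n, 0 ≤ M * (i : ℕ) ∧ M * (i : ℕ) + M ≤ t - s := by
    intro i
    refine ⟨by positivity, le_trans ?_ hnle⟩
    have : ((i : ℕ) : ℝ) + 1 ≤ n := by exact_mod_cast i.2
    have := mul_le_mul_of_nonneg_left this (by positivity : 0 ≤ M)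
    linarith
  have hsep : ∀ i j : Fin n, i < j → IsLSeparated L (c i) (c j) := by
    intro i j hij
    have hi := hpos i
    have hj := hpos j
    have hgap : M * (i : ℕ) + M ≤ M * (j : ℕ) := by
      have : ((i : ℕ) : ℝ) + 1 ≤ (j : ℕ) := by exact_mod_cast hij
      have := mul_le_mul_of_nonneg_left this (by positivity : 0 ≤ M)
      linarith
    exact ((hscale t ht).mono (Icc_subset_Icc (by linarith) (by linarith))).isLSeparated hX ha hR0
      (by linarith) (by linarith) (hcoord i) (hcoord j) (hc.1 i j hij.ne) hLge
  have hchain : IsLChain L c := by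
    refine ⟨hc, fun i j hij => ?_⟩
    rcases lt_or_gt_of_ne hij with hlt | hlt
    · exact hsep i j hlt
    · exact (hsep j i hlt).symm
  have hends : ∀ i, (c i).Separates {b s} {b t} := by
    intro i
    have hi := hpos i
    rw [Curtain.IsOrientation.separates_iff (Or.inl rfl) hX]
    left
    simp only [mem_singleton_iff, forall_eq, hcoord]
    rw [hX.projParam_self ha (mem_Ici.2 hs), hX.projParam_self ha (mem_Ici.2 ht)]
    constructor <;> linarith
  have hne : b s ≠ b t := by
    rw [← dist_pos, hb.1 s hs t ht]
    exact abs_pos.2 (sub_ne_zero.2 hst.ne)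
  refine le_trans (ENNReal.ofReal_le_ofReal ?_) (le_dHat_of_isLChain hL0 hne hchain hends)
  have hMle : M ≤ (4 * K + 2) * κ t := by nlinarith
  have hts : 0 ≤ t - s := sub_nonneg.2 hst.le
  have hLpos : (0 : ℝ) < L := by exact_mod_cast hL0
  -- The spacing `M` contributes one factor `κ t` and the weight `L ^ 3` three.
  calc 1 / ((4 * K + 2) * (6 * K + 4) ^ 3) * ((t - s) / κ t ^ 4) -
        1 / ((4 * K + 2) * (6 * K + 4) ^ 3)
      ≤ 1 / ((4 * K + 2) * (6 * K + 4) ^ 3) * ((t - s) / κ t ^ 4) :=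
        sub_le_self _ (by positivity)
    _ = (t - s) / ((4 * K + 2) * κ t) / ((6 * K + 4) * κ t) ^ 3 := by field_simp
    _ ≤ (t - s) / M / (L : ℝ) ^ 3 := by gcongr
    _ ≤ (1 + n) / (L : ℝ) ^ 3 := by gcongr

end Shadow

theorem theoremD {X : Type*} [MetricSpace X] (hX : IsCAT0 X)
    (κ : ℝ → ℝ) (hκ : IsSublinearFunction κ)
    (o : X) (b : ℝ → X) (hb : IsGeodesicRay o b) (hdiam : HasInfiniteDiamHat b) :
    (IsContractingRay κ o b → GrowsSublinearly (fun t => κ t ^ 4) →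
      HasPersistentShadow (fun t => κ t ^ 4) b) ∧
    (HasPersistentShadow κ b → GrowsSublinearly (fun t => κ t ^ 2) →
      IsContractingRay (fun t => κ t ^ 2) o b) :=
  ⟨fun h _ => h.hasPersistentShadow hX hκ hb, fun h _ => h.isContractingRay hX hκ hb⟩
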